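/- \textbf{Theorem (Local convergence of spherical SSGD).} Let $d\ge 2$, let $\mathcal S^{d-1}$ be the unit sphere of $\mathbb R^d$, let $F:\mathbb R^d\to\mathbb R$ be differentiable at every point of $\mathcal S^{d-1}$, and let $D:\mathbb R^d\to\mathbb R$ be positive on $\mathcal S^{d-1}$. Let $\zeta_1,\zeta_2,\dots$ be i.i.d. random elements and let $\Gamma(v;\zeta)\in\mathbb R^d$ be a (jointly measurable) stochastic vector with $\mathbb E\,\Gamma(v;\zeta_1)=D(v)\nabla F(v)$ for all $v\in\mathcal S^{d-1}$. For $\eta>0$ and a deterministic $v_0\in\mathcal S^{d-1}$ let $$v_t=\Pi_{\mathcal S^{d-1}}\big[v_{t-1}-\eta\,\Gamma(v_{t-1};\zeta_t)\big],\qquad t\ge1,$$ where $\Pi_{\mathcal S^{d-1}}$ is a nearest-point projection onto $\mathcal S^{d-1}$ (so $\Pi_{\mathcal S^{d-1}}[x]=x/\|x\|$ for $x\ne0$; its value at $0$ is any fixed unit vector). Let $v^*$ be a local minimizer of $F$ on $\mathcal S^{d-1}$, put $D=D(v^*)$, and let $\mu>0$ satisfy $$u^\top\Big(\nabla^2F(v^*)-\big({v^*}^\top\nabla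 F(v^*)\big)I\Big)u\ \ge\ \mu\qquad\text{for all unit vectors }u\perp v^*.$$ Assume: (i) for some $\delta\in(0,1]$ and positive constants $L_D,L_F,L_K,L_Q$, on $\{v:\|v\|\le1,\ \|v-v^*\|\le\delta\}$ the function $F$ is twice continuously differentiable (in a neighbourhood of each point) and $D(\cdot)$, $F$, $\nabla F$, $\nabla^2F$ are Lipschitz with constants $L_D,L_F,L_K,L_Q$ respectively (Euclidean norm for vectors, operator norm for matrices); (ii) for some $\alpha\in(0,2]$ and $\mathcal V>0$, $\mathbb E\exp\big(\|\Gamma(v;\zeta_1)\|^\alpha/\mathcal V^\alpha\big)\le2$ for all $v\in\mathcal S^{d-1}$. Set $$\rho=D\Big(2L_Q+\tfrac52L_F+\tfrac92L_K\Big)+L_D(L_K+2L_F),\qquad G_\alpha=\log_2^{1/\alpha}(1+e^{1/\alpha})\big(1+\log_2^{1/\alpha}(1+e^{1/\alpha})\big),$$ and for $\epsilon\in(0,1)$ and $0<\eta<1/(D\mu)$, $$K_{\eta,\epsilon}=\left\lceil\log_2\frac{\sqrt{D^3\mu^3}}{2^5\rho\,\mathcal V\log^{\frac{\alpha+2}{2\alpha}}(\epsilon^{-1})\,\eta^{1/2}}\right\rceil+1,\qquad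 T^*_\eta=\left\lceil\frac{2\log2}{-\log(1-D\mu\eta)}\right\rceil .$$ Suppose that $$\|v_0-v^*\|\le\min\Big\{\frac{D\mu}{2^5\rho},\ \frac\delta2\Big\},$$ that $\epsilon\in(0,1)$, that $0<\eta<1/(D\mu)$, and that $$\eta\le\min\Big\{\frac{D^3\mu^3}{2^{24}G_\alpha^2\mathcal V^2\rho^2},\ \frac{D\mu\,\delta^2}{2^{17}G_\alpha^2\mathcal V^2}\Big\}\log^{-\frac{\alpha+2}\alpha}(\epsilon^{-1}).$$ Then for every integer $T\ge K_{\eta,\epsilon}T^*_\eta$ there is an event $\mathcal H$ with $$\mathbb P(\mathcal H)\ \ge\ 1-\Big(14+8\big(\tfrac3\alpha\big)^{\frac2\alpha}\log^{-\frac{\alpha+2}\alpha}(\epsilon^{-1})\Big)T\epsilon$$ on which, for all integers $t\in[K_{\eta,\epsilon}T^*_\eta,\,T]$, $$\|v_t-v^*\|\ \le\ \frac{2^{17/2}G_\alpha\mathcal V}{\sqrt{D\mu}}\,\log^{\frac{\alpha+2}{2\alpha}}(\epsilon^{-1})\,\eta^{1/2}.$$ -/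

import Mathlib

open MeasureTheory ProbabilityTheory

noncomputable section

namespace SSGD

/-- `Pr` is a projection operator onto the unit sphere: every point is sent to a nearest point
of the sphere. This forces `Pr x = x / ‖x‖` for `x ≠ 0`; at the origin, where every point of the
sphere is nearest, the value may be any unit vector. -/
def IsSphereProjection {d : ℕ} (Pr : EuclideanSpace ℝ (Fin d) → EuclideanSpace ℝ (Fin d)) : Prop :=
  ∀ x, ‖Pr x‖ = 1 ∧ ∀ y : EuclideanSpace ℝ (Fin d), ‖y‖ = 1 → dist x (Pr x) ≤ dist x y

/-- The spherical SSGD iterates `v_{t+1} = Pr (v_t - η Γ(v_t; ζ))`. The sample consumed by the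
step from `v_t` to `v_{t+1}` is called `ζ t`, so the samples are numbered from `0`. -/
def iterate {d : ℕ} {Ω Z : Type*}
    (Pr : EuclideanSpace ℝ (Fin d) → EuclideanSpace ℝ (Fin d)) (η : ℝ)
    (Γ : EuclideanSpace ℝ (Fin d) → Z → EuclideanSpace ℝ (Fin d))
    (ζ : ℕ → Ω → Z) (v₀ : EuclideanSpace ℝ (Fin d)) : ℕ → Ω → EuclideanSpace ℝ (Fin d)
  | 0, _ => v₀
  | t + 1, ω => Pr (iterate Pr η Γ ζ v₀ t ω - η • Γ (iterate Pr η Γ ζ v₀ t ω) (ζ t ω))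

/-- The Hessian `∇²F(v)`, as an operator (with the operator norm). -/
def hess {d : ℕ} (F : EuclideanSpace ℝ (Fin d) → ℝ) (v : EuclideanSpace ℝ (Fin d)) :
    EuclideanSpace ℝ (Fin d) →L[ℝ] EuclideanSpace ℝ (Fin d) :=
  fderiv ℝ (gradient F) v

/-- The manifold Hessian `∇²F(v) - (vᵀ∇F(v) / ‖v‖²) I` of the unit sphere. -/
def manifoldHessian {d : ℕ} (F : EuclideanSpace ℝ (Fin d) → ℝ)
    (v : EuclideanSpace ℝ (Fin d)) :
    EuclideanSpace ℝ (Fin d) →L[ℝ] EuclideanSpace ℝ (Fin d) :=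
  hess F v - (inner ℝ v (gradient F v) / ‖v‖ ^ 2) •
    ContinuousLinearMap.id ℝ (EuclideanSpace ℝ (Fin d))

/-- The region `{v : ‖v‖ ≤ 1, ‖v - v*‖ ≤ δ}`. -/
def region {d : ℕ} (vs : EuclideanSpace ℝ (Fin d)) (δ : ℝ) : Set (EuclideanSpace ℝ (Fin d)) :=
  {v | ‖v‖ ≤ 1 ∧ ‖v - vs‖ ≤ δ}

/-- `f` is `L`-Lipschitz on `s`. -/
def LipOn {E M : Type*} [NormedAddCommGroup E] [NormedAddCommGroup M]
    (L : ℝ) (f : E → M) (s : Set E) : Prop :=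
  ∀ u ∈ s, ∀ w ∈ s, ‖f u - f w‖ ≤ L * ‖u - w‖

/-- Smoothness assumption: near every point of the region the objective is twice continuously
differentiable, and `D`, `F`, `∇F`, `∇²F` are Lipschitz on the region, with positive constants. -/
structure Smoothness {d : ℕ} (D F : EuclideanSpace ℝ (Fin d) → ℝ)
    (vs : EuclideanSpace ℝ (Fin d)) (δ L_D L_F L_K L_Q : ℝ) : Prop where
  pos_D : 0 < L_D
  pos_F : 0 < L_F
  pos_K : 0 < L_K
  pos_Q : 0 < L_Q
  contDiff : ∀ v ∈ region vs δ, ContDiffAt ℝ 2 F v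
  lip_D : LipOn L_D D (region vs δ)
  lip_F : LipOn L_F F (region vs δ)
  lip_grad : LipOn L_K (gradient F) (region vs δ)
  lip_hess : LipOn L_Q (hess F) (region vs δ)

/-- On the unit sphere, `Γ(v; ζ)` with `ζ ∼ ν` is an `α`-sub-Weibull vector with parameter `V`:
`E exp (‖Γ(v; ζ)‖^α / V^α) ≤ 2`. -/
def SubWeibull {d : ℕ} {Z : Type*} [MeasurableSpace Z] (ν : Measure Z)
    (Γ : EuclideanSpace ℝ (Fin d) → Z → EuclideanSpace ℝ (Fin d)) (α V : ℝ) : Prop :=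
  ∀ v : EuclideanSpace ℝ (Fin d), ‖v‖ = 1 →
    ∫⁻ z, ENNReal.ofReal (Real.exp (‖Γ v z‖ ^ α / V ^ α)) ∂ν ≤ 2

/-- `ρ = D (2 L_Q + (5/2) L_F + (9/2) L_K) + L_D (L_K + 2 L_F)`. -/
def rho (Ds L_D L_F L_K L_Q : ℝ) : ℝ :=
  Ds * (2 * L_Q + 5 / 2 * L_F + 9 / 2 * L_K) + L_D * (L_K + 2 * L_F)

/-- `G_α = log₂^{1/α}(1 + e^{1/α}) (1 + log₂^{1/α}(1 + e^{1/α}))`. -/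
def G (α : ℝ) : ℝ :=
  (Real.logb 2 (1 + Real.exp (1 / α))) ^ (1 / α) *
    (1 + (Real.logb 2 (1 + Real.exp (1 / α))) ^ (1 / α))

/-- The number of rounds `K_{η,ε}`. Under the step-size condition of the theorem the logarithm
is at least `7`, so the truncation of `⌈·⌉₊` at `0` is never active. -/
def K (Ds μ ρ V α η ε : ℝ) : ℕ :=
  ⌈Real.logb 2 (Real.sqrt (Ds ^ 3 * μ ^ 3) /
    (2 ^ 5 * ρ * V * (Real.log ε⁻¹) ^ ((α + 2) / (2 * α)) * η ^ (1 / 2 : ℝ)))⌉₊ + 1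

/-- The length `T*_η` of a round, for `0 < η < 1 / (D μ)`. -/
def Tstar (Ds μ η : ℝ) : ℕ :=
  ⌈2 * Real.log 2 / (-Real.log (1 - Ds * μ * η))⌉₊

end SSGD

end

/-! The squared distance `x t = ‖v t - vs‖ ^ 2` is a scalar potential, and the whole argument is a
supermartingale estimate for `exp (l * x t)`; no vector-valued concentration is needed.

Expanding the normalisation (`IsSphereProjection.norm_sub_sq_le`), one step changes `x` by at most
`2 η ⟪Γ, p⟫ + 4 η² ‖Γ‖²`, where `p` is the component of `vs` tangential to the sphere at `v`, with
`‖p‖² ≤ x`. The mean of the linear term is at most `-2 η D μ x` up to an error of order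
`ρ x ^ (3 / 2)` (`Smoothness.drift_le`): the gradient at the minimizer is radial, and the manifold
Hessian is bounded below by `μ` on its tangent space. In a ball twice as large (in squared radius)
as the warm start, the drift is therefore at least `1.6 D μ η x`.

The stochastic gradient is truncated at `M = V (log ε⁻¹) ^ (1 / α)`, which it exceeds with
probability at most `2 ε`. The truncated linear term is bounded by `2 η M √x`, so by Hoeffding's
lemma its exponential moment costs `2 (l η M)² x`. This is again proportional to `x`, hence for
`l ≤ L`, `L` of order `D μ / (η M²)`, it is absorbed by the surplus `0.6 D μ η x` of the drift,
together with the bias of the truncation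
(`lintegral_goodSteps_exp_le`). Thus on good steps the conditional expectation of `exp (l x⁺)` is
at most `exp (l ((1 - D μ η) x + κ))`. Iterating with the exponents `l (1 - D μ η) ^ k`
(`lintegral_good_exp_le`) gives
`E [exp (L x t); good steps so far] ≤ exp (L ((1 - D μ η) ^ t x 0 + κ / (D μ η)))`.

By Markov's inequality each of the events "`x t` leaves the ball" and "`x t` exceeds the final
level at a time `t ≥ K T*`" has probability at most `ε`: both levels are large multiples of the
stationary level `σ = V² (log ε⁻¹) ^ ((α + 2) / α) η / (D μ)`, and `L σ` is of order `log ε⁻¹`.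
The initial condition is forgotten since `(1 - D μ η) ^ T* ≤ 1 / 4`. A union bound
(`exists_event_of_step_bounds`) gives failure probability at most `4 T ε`. If `14 T ε ≥ 1` the
probability bound is void; otherwise `ε ≤ D μ η / 7` (`le_rate_of_Tstar_mul_lt`), which makes the
truncation bias negligible. -/

/-! ### The projected step on the sphere -/

namespace SSGD

variable {d : ℕ}

lemma IsSphereProjection.eq_smul {Pr : EuclideanSpace ℝ (Fin d) → EuclideanSpace ℝ (Fin d)}
    (hPr : IsSphereProjection Pr) {x : EuclideanSpace ℝ (Fin d)} (hx : x ≠ 0) :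
    Pr x = ‖x‖⁻¹ • x := by
  have hx' : 0 < ‖x‖ := norm_pos_iff.2 hx
  obtain ⟨h1, h2⟩ := hPr x
  have hu : ‖‖x‖⁻¹ • x‖ = 1 := by
    rw [norm_smul, norm_inv, norm_norm, inv_mul_cancel₀ hx'.ne']
  have h3 := h2 _ hu
  rw [dist_eq_norm, dist_eq_norm] at h3
  have h4 : ‖x - Pr x‖ ^ 2 ≤ ‖x - ‖x‖⁻¹ • x‖ ^ 2 := by gcongr
  rw [norm_sub_sq_real, norm_sub_sq_real, h1, hu, real_inner_smul_right,
    real_inner_self_eq_norm_sq] at h4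
  have h5 : ‖x‖⁻¹ * ‖x‖ ^ 2 = ‖x‖ := by field_simp
  have h6 : inner ℝ x (Pr x) = ‖x‖ * ‖Pr x‖ := by
    refine le_antisymm (real_inner_le_norm _ _) ?_
    rw [h1]; linarith
  rw [inner_eq_norm_mul_iff_real, h1, one_smul] at h6
  exact (eq_inv_smul_iff₀ hx'.ne').2 h6.symm

lemma IsSphereProjection.measurable {Pr : EuclideanSpace ℝ (Fin d) → EuclideanSpace ℝ (Fin d)}
    (hPr : IsSphereProjection Pr) : Measurable Pr := by
  classical
  have : Pr = fun x => if x = 0 then Pr 0 else ‖x‖⁻¹ • x := by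
    funext x
    by_cases hx : x = 0
    · simp [hx]
    · rw [if_neg hx, hPr.eq_smul hx]
  rw [this]
  exact Measurable.ite (measurableSet_singleton 0) measurable_const
    (measurable_norm.inv.smul measurable_id)

/-- One projected step, seen through the squared distance to a point `vs` of the sphere. The
normalisation turns `-h` into its tangential part at `v` up to second order, and only the
tangential part `vs - ⟪v, vs⟫ v` of `vs` pairs with `h`. -/
lemma IsSphereProjection.norm_sub_sq_le
    {Pr : EuclideanSpace ℝ (Fin d) → EuclideanSpace ℝ (Fin d)} (hPr : IsSphereProjection Pr)
    {v vs h : EuclideanSpace ℝ (Fin d)} (hv : ‖v‖ = 1) (hvs : ‖vs‖ = 1) {m : ℝ}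
    (hh : ‖h‖ ≤ m) (hm : m ≤ 1 / 2) (hc : 1 / 2 ≤ inner ℝ v vs) :
    ‖Pr (v - h) - vs‖ ^ 2
      ≤ ‖v - vs‖ ^ 2 + 2 * inner ℝ h (vs - (inner ℝ v vs : ℝ) • v) + 4 * m ^ 2 := by
  have hn : 1 / 2 ≤ ‖v - h‖ := by
    have := norm_sub_norm_le v h
    linarith
  have hn0 : 0 < ‖v - h‖ := by linarith
  have hm0 : 0 ≤ m := (norm_nonneg h).trans hh
  rw [hPr.eq_smul (norm_pos_iff.1 hn0), norm_sub_sq_real, norm_sub_sq_real, norm_smul, norm_inv,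
    norm_norm, inv_mul_cancel₀ hn0.ne', real_inner_smul_left, inner_sub_left, inner_sub_right,
    real_inner_smul_right, hv, hvs]
  have hnsq : ‖v - h‖ ^ 2 = 1 - 2 * inner ℝ v h + ‖h‖ ^ 2 := by
    rw [norm_sub_sq_real, hv]; ring
  have ha : |inner ℝ v h| ≤ m := by
    have := abs_real_inner_le_norm v h
    rw [hv, one_mul] at this; linarith
  have hb : |inner ℝ h vs| ≤ m := by
    have := abs_real_inner_le_norm h vs
    rw [hvs, mul_one] at this; linarith
  have hc1 : (inner ℝ v vs : ℝ) ≤ 1 := by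
    have := real_inner_le_norm v vs
    rw [hv, hvs] at this; linarith
  rw [real_inner_comm v h]
  set n := ‖v - h‖
  set a : ℝ := inner ℝ v h
  set b : ℝ := inner ℝ h vs
  set c : ℝ := inner ℝ v vs
  have hh2 : ‖h‖ ^ 2 ≤ m ^ 2 := by gcongr
  rw [abs_le] at ha hb
  -- the tangent line of `s ↦ s ^ (-1 / 2)` at `1`, evaluated at `s = n ^ 2`
  have hinv : (3 - n ^ 2) / 2 ≤ n⁻¹ := by
    rw [inv_eq_one_div, le_div_iff₀ hn0]
    nlinarith [mul_nonneg (sq_nonneg (n - 1)) (by linarith : 0 ≤ n + 2)]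
  have hcb : 0 ≤ c - b := by linarith
  have h1 : (c - b) * ((3 - n ^ 2) / 2) ≤ (c - b) * n⁻¹ := by gcongr
  have h2 : a * b ≤ m ^ 2 := by nlinarith
  have h3 : (c - b) * ‖h‖ ^ 2 ≤ 2 * m ^ 2 := by nlinarith [sq_nonneg ‖h‖]
  rw [hnsq] at h1
  nlinarith

/-! ### The drift of the mean step near the minimizer -/

lemma convex_region (vs : EuclideanSpace ℝ (Fin d)) (δ : ℝ) : Convex ℝ (region vs δ) := by
  have : region vs δ = Metric.closedBall 0 1 ∩ Metric.closedBall vs δ := by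
    ext v; simp [region, dist_eq_norm]
  rw [this]
  exact (convex_closedBall _ _).inter (convex_closedBall _ _)

lemma mem_region_self {vs : EuclideanSpace ℝ (Fin d)} (hvs : ‖vs‖ = 1) {δ : ℝ} (hδ : 0 < δ) :
    vs ∈ region vs δ := by
  simp [region, hvs, hδ.le]

/-- `vs` lies on the boundary of the region, but the directions pointing into the region form an
open half-space, which together with its negative is dense; so a Lipschitz bound on the region
still bounds the whole derivative at `vs`. -/
lemma LipOn.norm_hasFDerivAt_apply_le {M : Type*} [NormedAddCommGroup M] [NormedSpace ℝ M]
    {f : EuclideanSpace ℝ (Fin d) → M} {f' : EuclideanSpace ℝ (Fin d) →L[ℝ] M}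
    {vs : EuclideanSpace ℝ (Fin d)} (hvs : ‖vs‖ = 1) {δ L : ℝ} (hδ : 0 < δ)
    (hL : LipOn L f (region vs δ)) (hf : HasFDerivAt f f' vs) (h : EuclideanSpace ℝ (Fin d)) :
    ‖f' h‖ ≤ L * ‖h‖ := by
  have inward : ∀ h : EuclideanSpace ℝ (Fin d), inner ℝ vs h < 0 → ‖f' h‖ ≤ L * ‖h‖ := by
    intro h hh
    have h1 := (hf.hasLineDerivAt h).tendsto_slope_zero_right
    refine le_of_tendsto h1.norm ?_
    have e1 : ∀ᶠ t : ℝ in nhdsWithin 0 (Set.Ioi 0), 2 * inner ℝ vs h + t * ‖h‖ ^ 2 < 0 := by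
      have : Filter.Tendsto (fun t : ℝ => 2 * inner ℝ vs h + t * ‖h‖ ^ 2) (nhdsWithin 0 (Set.Ioi 0))
          (nhds (2 * inner ℝ vs h + 0 * ‖h‖ ^ 2)) :=
        ((by fun_prop : Continuous fun t : ℝ => 2 * inner ℝ vs h + t * ‖h‖ ^ 2).tendsto 0).mono_left
          nhdsWithin_le_nhds
      exact this.eventually_lt_const (by linarith)
    have e2 : ∀ᶠ t : ℝ in nhdsWithin 0 (Set.Ioi 0), t * ‖h‖ < δ := by
      have : Filter.Tendsto (fun t : ℝ => t * ‖h‖) (nhdsWithin 0 (Set.Ioi 0))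
          (nhds (0 * ‖h‖)) :=
        ((by fun_prop : Continuous fun t : ℝ => t * ‖h‖).tendsto 0).mono_left
          nhdsWithin_le_nhds
      exact this.eventually_lt_const (by linarith)
    filter_upwards [e1, e2, self_mem_nhdsWithin] with t h1 h2 (ht : 0 < t)
    have hmem : vs + t • h ∈ region vs δ := by
      constructor
      · have : ‖vs + t • h‖ ^ 2 ≤ 1 := by
          rw [norm_add_sq_real, hvs, real_inner_smul_right, norm_smul, Real.norm_eq_abs,
            abs_of_pos ht]
          nlinarith
        exact (sq_le_one_iff₀ (norm_nonneg _)).1 this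
      · rw [add_sub_cancel_left, norm_smul, Real.norm_eq_abs, abs_of_pos ht]
        exact h2.le
    have h3 := hL _ hmem _ (mem_region_self hvs hδ)
    rw [add_sub_cancel_left, norm_smul, Real.norm_eq_abs, abs_of_pos ht] at h3
    rw [norm_smul, norm_inv, Real.norm_eq_abs, abs_of_pos ht, inv_mul_le_iff₀ ht]
    linarith
  have weak : ∀ h : EuclideanSpace ℝ (Fin d), inner ℝ vs h ≤ 0 → ‖f' h‖ ≤ L * ‖h‖ := by
    intro h hh
    have c1 : Filter.Tendsto (fun s : ℝ => ‖f' (h - s • vs)‖) (nhdsWithin 0 (Set.Ioi 0))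
        (nhds ‖f' (h - (0 : ℝ) • vs)‖) :=
      ((by fun_prop : Continuous fun s : ℝ => ‖f' (h - s • vs)‖).tendsto 0).mono_left
        nhdsWithin_le_nhds
    have c2 : Filter.Tendsto (fun s : ℝ => L * ‖h - s • vs‖) (nhdsWithin 0 (Set.Ioi 0))
        (nhds (L * ‖h - (0 : ℝ) • vs‖)) :=
      ((by fun_prop : Continuous fun s : ℝ => L * ‖h - s • vs‖).tendsto 0).mono_left
        nhdsWithin_le_nhds
    rw [zero_smul, sub_zero] at c1 c2
    refine le_of_tendsto_of_tendsto c1 c2 ?_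
    filter_upwards [self_mem_nhdsWithin] with s (hs : 0 < s)
    apply inward
    rw [inner_sub_right, real_inner_smul_right, real_inner_self_eq_norm_sq, hvs]
    linarith
  rcases le_total (inner ℝ vs h) 0 with hh | hh
  · exact weak h hh
  · have := weak (-h) (by rw [inner_neg_right]; linarith)
    rwa [map_neg, norm_neg, norm_neg] at this

lemma differentiableAt_gradient {F : EuclideanSpace ℝ (Fin d) → ℝ} {v : EuclideanSpace ℝ (Fin d)}
    (hF : ContDiffAt ℝ 2 F v) : DifferentiableAt ℝ (gradient F) v := by
  have h1 : DifferentiableAt ℝ (fderiv ℝ F) v :=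
    (hF.fderiv_right (m := 1) (by norm_num)).differentiableAt (by norm_num)
  exact ((InnerProductSpace.toDual ℝ
    (EuclideanSpace ℝ (Fin d))).symm.toContinuousLinearEquiv.differentiableAt).comp v h1

lemma inner_gradient {F : EuclideanSpace ℝ (Fin d) → ℝ} (v u : EuclideanSpace ℝ (Fin d)) :
    inner ℝ (gradient F v) u = fderiv ℝ F v u := by
  rw [gradient, InnerProductSpace.toDual_symm_apply]

/-- First-order optimality on the sphere: the gradient at a local minimizer is radial. -/
lemma gradient_eq_inner_smul {F : EuclideanSpace ℝ (Fin d) → ℝ} {vs : EuclideanSpace ℝ (Fin d)}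
    (hvs : ‖vs‖ = 1) (hF : DifferentiableAt ℝ F vs)
    (hmin : IsLocalMinOn F (Metric.sphere 0 1) vs) :
    gradient F vs = (inner ℝ vs (gradient F vs) : ℝ) • vs := by
  have tang : ∀ u : EuclideanSpace ℝ (Fin d), ‖u‖ = 1 → inner ℝ vs u = 0 →
      inner ℝ (gradient F vs) u = 0 := by
    intro u hu hort
    -- restrict `F` to the great circle through `vs` in the direction `u`
    let γ : ℝ → EuclideanSpace ℝ (Fin d) := fun t => Real.cos t • vs + Real.sin t • u
    have hγ0 : γ 0 = vs := by simp [γ]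
    have hγ : HasDerivAt γ u 0 := by
      have h : HasDerivAt γ (-Real.sin 0 • vs + Real.cos 0 • u) 0 :=
        ((Real.hasDerivAt_cos 0).smul_const vs).add ((Real.hasDerivAt_sin 0).smul_const u)
      simpa using h
    have hsph : ∀ t, γ t ∈ Metric.sphere (0 : EuclideanSpace ℝ (Fin d)) 1 := by
      intro t
      rw [mem_sphere_zero_iff_norm, ← sq_eq_sq₀ (norm_nonneg _) zero_le_one]
      simp only [γ]
      rw [norm_add_sq_real, norm_smul, norm_smul, real_inner_smul_left,
        real_inner_smul_right, hort, hvs, hu, Real.norm_eq_abs, Real.norm_eq_abs, mul_pow, mul_pow,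
        sq_abs, sq_abs]
      linarith [Real.sin_sq_add_cos_sq t]
    have hmin' : IsLocalMin (F ∘ γ) 0 := by
      have hc : Filter.Tendsto γ (nhds 0) (nhdsWithin vs (Metric.sphere 0 1)) := by
        refine tendsto_nhdsWithin_iff.2 ⟨?_, Filter.Eventually.of_forall hsph⟩
        have := hγ.continuousAt.tendsto
        rwa [hγ0] at this
      have := hc.eventually hmin
      filter_upwards [this] with t ht
      simpa [hγ0] using ht
    have hd : HasDerivAt (F ∘ γ) (fderiv ℝ F vs u) 0 := by
      have h1 : HasFDerivAt F (fderiv ℝ F vs) (γ 0) := by rw [hγ0]; exact hF.hasFDerivAt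
      exact h1.comp_hasDerivAt 0 hγ
    rw [inner_gradient]
    exact hmin'.hasDerivAt_eq_zero hd
  set g := gradient F vs
  set q := g - (inner ℝ vs g : ℝ) • vs with hq
  have hqv : inner ℝ vs q = 0 := by
    rw [hq, inner_sub_right, real_inner_smul_right, real_inner_self_eq_norm_sq, hvs]; ring
  have hq0 : q = 0 := by
    by_contra hne
    have hn : ‖q‖ ≠ 0 := norm_ne_zero_iff.2 hne
    have h1 := tang (‖q‖⁻¹ • q) (by rw [norm_smul, norm_inv, norm_norm, inv_mul_cancel₀ hn])
      (by rw [real_inner_smul_right, hqv, mul_zero])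
    rw [real_inner_smul_right, mul_eq_zero] at h1
    have h2 : inner ℝ g q = 0 := h1.resolve_left (inv_ne_zero hn)
    have h3 : inner ℝ q q = (0 : ℝ) := by
      conv_lhs => rw [hq]
      rw [← hq, inner_sub_left, h2, real_inner_smul_left, hqv]; ring
    exact hne (inner_self_eq_zero.1 h3)
  exact sub_eq_zero.1 hq0

lemma Smoothness.norm_gradient_sub_sub_le {D F : EuclideanSpace ℝ (Fin d) → ℝ}
    {vs : EuclideanSpace ℝ (Fin d)} {δ L_D L_F L_K L_Q : ℝ}
    (hs : Smoothness D F vs δ L_D L_F L_K L_Q) (hvs : ‖vs‖ = 1) (hδ : 0 < δ)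
    {v : EuclideanSpace ℝ (Fin d)} (hv : v ∈ region vs δ) :
    ‖gradient F v - gradient F vs - hess F vs (v - vs)‖ ≤ L_Q * ‖v - vs‖ ^ 2 := by
  have hsub : ∀ w ∈ region vs ‖v - vs‖, w ∈ region vs δ := fun w hw => ⟨hw.1, hw.2.trans hv.2⟩
  have h := (convex_region vs ‖v - vs‖).norm_image_sub_le_of_norm_hasFDerivWithin_le'
    (f := gradient F) (f' := hess F) (φ := hess F vs) (C := L_Q * ‖v - vs‖) (x := vs) (y := v)
    (fun w hw => (differentiableAt_gradient
      (hs.contDiff w (hsub w hw))).hasFDerivAt.hasFDerivWithinAt)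
    (fun w hw => (hs.lip_hess w (hsub w hw) vs (mem_region_self hvs hδ)).trans
      (mul_le_mul_of_nonneg_left hw.2 hs.pos_Q.le))
    ⟨hvs.le, by simp⟩ ⟨hv.1, le_rfl⟩
  calc _ ≤ _ := h
    _ = _ := by ring

set_option maxHeartbeats 1000000 in
/-- The drift towards `vs`: near `vs` the mean step reduces the squared distance at rate `D μ`,
up to a cubic error. Both `v - vs` and the tangential part of `vs` at `v` are decomposed along
`vs` and `u = v - ⟪v, vs⟫ vs`, on which the manifold Hessian is bounded below. -/
lemma Smoothness.drift_le {D F : EuclideanSpace ℝ (Fin d) → ℝ}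
    {vs : EuclideanSpace ℝ (Fin d)} {δ L_D L_F L_K L_Q μ : ℝ}
    (hs : Smoothness D F vs δ L_D L_F L_K L_Q) (hvs : ‖vs‖ = 1) (hδ : 0 < δ) (hδ_one : δ ≤ 1)
    (hDpos : 0 < D vs) (hmin : IsLocalMinOn F (Metric.sphere 0 1) vs)
    (hμ : ∀ u : EuclideanSpace ℝ (Fin d), inner ℝ u vs = 0 → ‖u‖ = 1 →
      μ ≤ inner ℝ u (manifoldHessian F vs u))
    {v : EuclideanSpace ℝ (Fin d)} (hv : ‖v‖ = 1) (hvδ : ‖v - vs‖ ≤ δ) :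
    D v * inner ℝ (gradient F v) (vs - (inner ℝ v vs : ℝ) • v)
      ≤ -(D vs * μ) * (‖v - vs‖ ^ 2 - ‖v - vs‖ ^ 4 / 4)
        + rho (D vs) L_D L_F L_K L_Q * ‖v - vs‖ ^ 3 := by
  have hvs_mem := mem_region_self hvs hδ
  have hv_mem : v ∈ region vs δ := ⟨hv.le, hvδ⟩
  have hgrad := gradient_eq_inner_smul hvs
    ((hs.contDiff vs hvs_mem).differentiableAt (by norm_num)) hmin
  have hR := hs.norm_gradient_sub_sub_le hvs hδ hv_mem
  have hH := hs.lip_grad.norm_hasFDerivAt_apply_le hvs hδ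
    (differentiableAt_gradient (hs.contDiff vs hvs_mem)).hasFDerivAt
  have hκ : |inner ℝ vs (gradient F vs)| ≤ L_F := by
    have h := hs.lip_F.norm_hasFDerivAt_apply_le hvs hδ
      ((hs.contDiff vs hvs_mem).differentiableAt (by norm_num)).hasFDerivAt vs
    rwa [← inner_gradient, hvs, mul_one, real_inner_comm, Real.norm_eq_abs] at h
  have hD := hs.lip_D v hv_mem vs hvs_mem
  have hK := hs.lip_grad v hv_mem vs hvs_mem
  rw [Real.norm_eq_abs] at hD
  change ∀ h, ‖hess F vs h‖ ≤ L_K * ‖h‖ at hH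
  have hc : (inner ℝ v vs : ℝ) = 1 - ‖v - vs‖ ^ 2 / 2 := by
    rw [norm_sub_sq_real, hv, hvs]; ring
  set H := hess F vs with hHdef
  set κ : ℝ := inner ℝ vs (gradient F vs) with hκdef
  set g := gradient F v
  set c : ℝ := inner ℝ v vs with hcdef
  set n := ‖v - vs‖ with hn
  have hn0 : 0 ≤ n := norm_nonneg _
  have hn1 : n ≤ 1 := hvδ.trans hδ_one
  set u := v - c • vs with hu
  set p := vs - c • v with hp
  set w := n ^ 2 - n ^ 4 / 4 with hw
  have hw_c : w = 1 - c ^ 2 := by rw [hc]; ring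
  have hu_vs : inner ℝ u vs = (0 : ℝ) := by
    rw [hu, inner_sub_left, real_inner_smul_left, real_inner_self_eq_norm_sq, hvs, ← hcdef]; ring
  have hu_sq : ‖u‖ ^ 2 = w := by
    rw [hu, norm_sub_sq_real, real_inner_smul_right, norm_smul, hv, hvs, ← hcdef, mul_one,
      Real.norm_eq_abs, sq_abs, hw_c]; ring
  have hp_sq : ‖p‖ ^ 2 = w := by
    rw [hp, norm_sub_sq_real, real_inner_smul_right, norm_smul, hv, hvs, real_inner_comm, ← hcdef,
      mul_one, Real.norm_eq_abs, sq_abs, hw_c]; ring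
  have hw0 : 0 ≤ w := by rw [← hu_sq]; positivity
  have hwn : w ≤ n ^ 2 := by rw [hw]; linarith [pow_nonneg hn0 4]
  have hun : ‖u‖ ≤ n := by
    refine le_of_sq_le_sq ?_ hn0
    rw [hu_sq]; exact hwn
  have hpn : ‖p‖ ≤ n := by
    refine le_of_sq_le_sq ?_ hn0
    rw [hp_sq]; exact hwn
  have hp_eq : p = w • vs - c • u := by
    rw [hp, hu, hw_c]; module
  have he_eq : v - vs = u - (n ^ 2 / 2) • vs := by
    have : n ^ 2 / 2 = 1 - c := by rw [hc]; ring
    rw [this, hu]; module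
  have hbil : ∀ a b : EuclideanSpace ℝ (Fin d), |inner ℝ (H a) b| ≤ L_K * ‖a‖ * ‖b‖ := fun a b =>
    (abs_real_inner_le_norm _ _).trans (by gcongr; exact hH a)
  have hg0p : inner ℝ (gradient F vs) p = κ * w := by
    rw [hgrad, real_inner_smul_left, hp, inner_sub_right, real_inner_smul_right,
      real_inner_self_eq_norm_sq, hvs, real_inner_comm, ← hcdef, hw_c]; ring
  have hHe : inner ℝ (H (v - vs)) p = -(c * inner ℝ (H u) u) + w * inner ℝ (H u) vs
      - n ^ 2 / 2 * w * inner ℝ (H vs) vs + n ^ 2 / 2 * c * inner ℝ (H vs) u := by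
    rw [he_eq, hp_eq, map_sub, map_smul]
    simp only [inner_sub_left, inner_sub_right, real_inner_smul_left, real_inner_smul_right]
    ring
  have hcurv : μ * w ≤ inner ℝ (H u) u - κ * w := by
    by_cases hu0 : u = 0
    · rw [← hu_sq, hu0]; simp
    · have hun0 : ‖u‖ ≠ 0 := norm_ne_zero_iff.2 hu0
      have h := hμ (‖u‖⁻¹ • u) (by rw [real_inner_smul_left, hu_vs, mul_zero])
        (by rw [norm_smul, norm_inv, norm_norm, inv_mul_cancel₀ hun0])
      have hM : manifoldHessian F vs u = H u - κ • u := by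
        simp [manifoldHessian, hvs, hκdef, hHdef]
      rw [map_smul, real_inner_smul_left, real_inner_smul_right, hM, inner_sub_right,
        real_inner_smul_right, real_inner_self_eq_norm_sq, real_inner_comm] at h
      rw [← hu_sq]
      calc μ * ‖u‖ ^ 2 ≤ (‖u‖⁻¹ * (‖u‖⁻¹ * (inner ℝ (H u) u - κ * ‖u‖ ^ 2))) * ‖u‖ ^ 2 := by
            gcongr
        _ = _ := by field_simp
  have hRp : inner ℝ (g - gradient F vs - H (v - vs)) p ≤ L_Q * n ^ 2 * n :=
    (real_inner_le_norm _ _).trans (by gcongr; exact mul_nonneg hs.pos_Q.le (sq_nonneg n))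
  have hsplit : inner ℝ g p = κ * w + inner ℝ (H (v - vs)) p
      + inner ℝ (g - gradient F vs - H (v - vs)) p := by
    rw [inner_sub_left, inner_sub_left, hg0p]; ring
  have hsplit' : inner ℝ g p = κ * w + inner ℝ (g - gradient F vs) p := by
    rw [inner_sub_left, hg0p]; ring
  have hgp : |inner ℝ g p| ≤ (L_F + L_K) * n ^ 2 := by
    have h1 : |inner ℝ (g - gradient F vs) p| ≤ L_K * n * n :=
      (abs_real_inner_le_norm _ _).trans (by gcongr; exact mul_nonneg hs.pos_K.le hn0)
    rw [hsplit']
    calc _ ≤ |κ * w| + |inner ℝ (g - gradient F vs) p| := abs_add_le _ _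
      _ ≤ L_F * n ^ 2 + L_K * n * n := by
          rw [abs_mul, abs_of_nonneg hw0]
          gcongr
          exact hs.pos_F.le
      _ = _ := by ring
  have hLK := hs.pos_K.le
  have ba : |inner ℝ (H u) u| ≤ L_K * n ^ 2 :=
    (hbil u u).trans (by rw [mul_assoc, ← sq]; gcongr)
  have b1 : |inner ℝ (H u) vs| ≤ L_K * n := (hbil u vs).trans (by rw [hvs, mul_one]; gcongr)
  have b2 : |inner ℝ (H vs) vs| ≤ L_K := (hbil vs vs).trans (by rw [hvs]; simp)
  have b3 : |inner ℝ (H vs) u| ≤ L_K * n :=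
    (hbil vs u).trans (by rw [hvs, mul_one]; gcongr)
  have hn43 : n ^ 4 ≤ n ^ 3 := pow_le_pow_of_le_one hn0 hn1 (by norm_num)
  have hφ : inner ℝ g p ≤ -(μ * w) + (5 / 2 * L_K + L_Q) * n ^ 3 := by
    rw [hsplit, hHe]
    have t0 : (1 - c) * inner ℝ (H u) u ≤ n ^ 2 / 2 * (L_K * n ^ 2) := by
      rw [hc, sub_sub_cancel]
      gcongr
      exact (le_abs_self _).trans ba
    have t1 : w * inner ℝ (H u) vs ≤ n ^ 2 * (L_K * n) := by
      calc _ ≤ w * (L_K * n) := by gcongr; exact (le_abs_self _).trans b1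
        _ ≤ _ := by gcongr
    have t2 : -(n ^ 2 / 2 * w * inner ℝ (H vs) vs) ≤ n ^ 2 / 2 * n ^ 2 * L_K := by
      calc _ = n ^ 2 / 2 * w * -inner ℝ (H vs) vs := by ring
        _ ≤ n ^ 2 / 2 * w * L_K := by gcongr; exact (neg_le_abs _).trans b2
        _ ≤ _ := by gcongr
    have t3 : n ^ 2 / 2 * c * inner ℝ (H vs) u ≤ n ^ 2 / 2 * 1 * (L_K * n) := by
      have hc0 : 0 ≤ c := by rw [hc]; nlinarith
      have hc1 : c ≤ 1 := by rw [hc]; nlinarith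
      calc _ ≤ n ^ 2 / 2 * c * (L_K * n) := by gcongr; exact (le_abs_self _).trans b3
        _ ≤ _ := by gcongr
    have t4 : L_K * n ^ 4 ≤ L_K * n ^ 3 := by gcongr
    linarith
  have hfin : (D v - D vs) * inner ℝ g p ≤ L_D * n * ((L_F + L_K) * n ^ 2) := by
    refine (le_abs_self _).trans ?_
    rw [abs_mul]
    gcongr
    exact mul_nonneg hs.pos_D.le hn0
  have hmain : D vs * inner ℝ g p ≤ D vs * (-(μ * w) + (5 / 2 * L_K + L_Q) * n ^ 3) := by
    gcongr
  have hrho : (D vs * (5 / 2 * L_K + L_Q) + L_D * (L_F + L_K)) * n ^ 3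
      ≤ rho (D vs) L_D L_F L_K L_Q * n ^ 3 := by
    have := hs.pos_D; have := hs.pos_F; have := hs.pos_K; have := hs.pos_Q
    gcongr
    unfold rho
    have e1 : D vs * (5 / 2 * L_K + L_Q) ≤ D vs * (2 * L_Q + 5 / 2 * L_F + 9 / 2 * L_K) := by
      exact mul_le_mul_of_nonneg_left (by linarith) hDpos.le
    have e2 : L_D * (L_F + L_K) ≤ L_D * (L_K + 2 * L_F) :=
      mul_le_mul_of_nonneg_left (by linarith) hs.pos_D.le
    linarith
  linarith

/-! ### Truncation of sub-Weibull variables -/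

lemma rpow_le_rpow_mul_exp {s p : ℝ} (hs : 0 ≤ s) (hp : 0 < p) :
    s ^ p ≤ p ^ p * Real.exp (s / 2) := by
  have h1 : s / (2 * p) ≤ Real.exp (s / (2 * p) - 1) := by
    have := Real.add_one_le_exp (s / (2 * p) - 1)
    linarith
  have h2 : s ≤ p * Real.exp (s / (2 * p)) := by
    rw [Real.exp_sub, le_div_iff₀ (Real.exp_pos 1)] at h1
    have he : (2 : ℝ) ≤ Real.exp 1 := by have := Real.add_one_le_exp (1 : ℝ); linarith
    have h3 : s / (2 * p) * 2 ≤ Real.exp (s / (2 * p)) :=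
      (mul_le_mul_of_nonneg_left he (by positivity)).trans h1
    have h4 : s / (2 * p) * 2 = s / p := by field_simp
    rw [h4, div_le_iff₀ hp] at h3
    linarith
  calc s ^ p ≤ (p * Real.exp (s / (2 * p))) ^ p := Real.rpow_le_rpow hs h2 hp.le
    _ = p ^ p * Real.exp (s / 2) := by
      rw [Real.mul_rpow hp.le (Real.exp_pos _).le, ← Real.exp_mul]
      congr 2
      field_simp

section Tails

variable {Z : Type*} [MeasurableSpace Z] {ν : Measure Z} {X : Z → ℝ} {α V : ℝ}

lemma le_mul_exp_half {x : ℝ} (hα : 0 < α) (hV : 0 < V) (hx : 0 ≤ x) :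
    x ≤ V * (1 / α) ^ (1 / α) * Real.exp (x ^ α / V ^ α / 2) := by
  have h := rpow_le_rpow_mul_exp (s := x ^ α / V ^ α) (by positivity) (one_div_pos.2 hα)
  rw [← Real.div_rpow hx hV.le, one_div, Real.rpow_rpow_inv (by positivity) hα.ne',
    div_le_iff₀ hV, ← one_div] at h
  rw [← Real.div_rpow hx hV.le]
  linarith

lemma truncation_level_rpow (hα : 0 < α) (hV : 0 < V) {l : ℝ} (hl : 0 ≤ l) :
    (V * l ^ (1 / α)) ^ α / V ^ α = l := by
  rw [Real.mul_rpow hV.le (by positivity), one_div, Real.rpow_inv_rpow hl hα.ne',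
    mul_div_cancel_left₀ _ (by positivity)]

lemma level_le_of_truncation_lt (hα : 0 < α) (hV : 0 < V) {l x : ℝ} (hl : 0 ≤ l)
    (hx : V * l ^ (1 / α) < x) : l ≤ x ^ α / V ^ α := by
  rw [← truncation_level_rpow hα hV hl]
  gcongr

lemma measure_truncation_lt_le (hα : 0 < α) (hV : 0 < V) (hX : Measurable X)
    (h : ∫⁻ z, ENNReal.ofReal (Real.exp (X z ^ α / V ^ α)) ∂ν ≤ 2) {ε : ℝ} (hε : 0 < ε)
    (hε1 : ε < 1) :
    ν {z | V * (Real.log ε⁻¹) ^ (1 / α) < X z} ≤ ENNReal.ofReal (2 * ε) := by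
  have hl : 0 ≤ Real.log ε⁻¹ := Real.log_nonneg (one_le_inv_iff₀.2 ⟨hε, hε1.le⟩)
  have hmeas : Measurable fun z => ENNReal.ofReal (Real.exp (X z ^ α / V ^ α)) := by fun_prop
  have h1 := (mul_meas_ge_le_lintegral hmeas (ENNReal.ofReal ε⁻¹) (μ := ν)).trans h
  have h2 : ν {z | V * (Real.log ε⁻¹) ^ (1 / α) < X z}
      ≤ ν {z | ENNReal.ofReal ε⁻¹ ≤ ENNReal.ofReal (Real.exp (X z ^ α / V ^ α))} := by
    refine measure_mono fun z hz => ?_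
    refine ENNReal.ofReal_le_ofReal ?_
    rw [← Real.exp_log (inv_pos.2 hε)]
    exact Real.exp_le_exp.2 (level_le_of_truncation_lt hα hV hl hz)
  calc _ ≤ _ := h2
    _ = ENNReal.ofReal ε * (ENNReal.ofReal ε⁻¹ *
          ν {z | ENNReal.ofReal ε⁻¹ ≤ ENNReal.ofReal (Real.exp (X z ^ α / V ^ α))}) := by
        rw [← mul_assoc, ← ENNReal.ofReal_mul hε.le, mul_inv_cancel₀ hε.ne', ENNReal.ofReal_one,
          one_mul]
    _ ≤ ENNReal.ofReal ε * 2 := by gcongr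
    _ = ENNReal.ofReal (2 * ε) := by
        rw [mul_comm, ENNReal.ofReal_mul zero_le_two, ENNReal.ofReal_ofNat]

lemma integrable_exp_of_lintegral_le (hX : Measurable X)
    (h : ∫⁻ z, ENNReal.ofReal (Real.exp (X z ^ α / V ^ α)) ∂ν ≤ 2) :
    Integrable (fun z => Real.exp (X z ^ α / V ^ α)) ν := by
  refine ⟨(by fun_prop : Measurable _).aestronglyMeasurable, ?_⟩
  rw [hasFiniteIntegral_iff_ofReal (Filter.Eventually.of_forall fun z => (Real.exp_pos _).le)]
  exact h.trans_lt (by norm_num)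

lemma integrable_of_lintegral_exp_le (hα : 0 < α) (hV : 0 < V) (hX : Measurable X)
    (hX0 : ∀ z, 0 ≤ X z) (h : ∫⁻ z, ENNReal.ofReal (Real.exp (X z ^ α / V ^ α)) ∂ν ≤ 2) :
    Integrable X ν := by
  refine ((integrable_exp_of_lintegral_le hX h).const_mul (V * (1 / α) ^ (1 / α))).mono'
    hX.aestronglyMeasurable (Filter.Eventually.of_forall fun z => ?_)
  rw [Real.norm_eq_abs, abs_of_nonneg (hX0 z)]
  refine (le_mul_exp_half hα hV (hX0 z)).trans ?_
  have : 0 ≤ X z ^ α / V ^ α := by have := hX0 z; positivity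
  exact mul_le_mul_of_nonneg_left (Real.exp_le_exp.2 (half_le_self this)) (by positivity)

/-- The mass lost by truncation: half of the exponential moment bounds the first power, the other
half is at least `ε ^ (-1 / 2)` beyond the truncation level. -/
lemma integral_indicator_truncation_le (hα : 0 < α) (hV : 0 < V) (hX : Measurable X)
    (hX0 : ∀ z, 0 ≤ X z) (h : ∫⁻ z, ENNReal.ofReal (Real.exp (X z ^ α / V ^ α)) ∂ν ≤ 2) {ε : ℝ}
    (hε : 0 < ε) (hε1 : ε < 1) :
    ∫ z, {z | V * (Real.log ε⁻¹) ^ (1 / α) < X z}.indicator X z ∂ν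
      ≤ 2 * V * (1 / α) ^ (1 / α) * Real.sqrt ε := by
  have hl : 0 ≤ Real.log ε⁻¹ := Real.log_nonneg (one_le_inv_iff₀.2 ⟨hε, hε1.le⟩)
  have hint := integrable_exp_of_lintegral_le hX h
  have hE : ∫ z, Real.exp (X z ^ α / V ^ α) ∂ν ≤ 2 := by
    rw [integral_eq_lintegral_of_nonneg_ae (Filter.Eventually.of_forall fun z => (Real.exp_pos _).le)
      hint.1]
    exact ENNReal.toReal_le_of_le_ofReal zero_le_two (by simpa using h)
  calc _ ≤ ∫ z, V * (1 / α) ^ (1 / α) * Real.sqrt ε * Real.exp (X z ^ α / V ^ α) ∂ν := by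
        refine integral_mono_of_nonneg (Filter.Eventually.of_forall fun z => ?_)
          (hint.const_mul _) (Filter.Eventually.of_forall fun z => ?_)
        · exact Set.indicator_nonneg (fun z _ => hX0 z) z
        · by_cases hz : V * (Real.log ε⁻¹) ^ (1 / α) < X z
          · rw [Set.indicator_of_mem (show z ∈ {z | _ < X z} from hz)]
            refine (le_mul_exp_half hα hV (hX0 z)).trans ?_
            have hs := level_le_of_truncation_lt hα hV hl hz
            dsimp only
            rw [mul_assoc _ (Real.sqrt ε)]
            gcongr
            have h1 : Real.sqrt ε = Real.exp (-(Real.log ε⁻¹) / 2) := by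
              rw [Real.log_inv, neg_neg, Real.exp_half, Real.exp_log hε]
            rw [h1, ← Real.exp_add]
            gcongr
            linarith
          · rw [Set.indicator_of_notMem (show z ∉ {z | _ < X z} from hz)]
            positivity
    _ ≤ V * (1 / α) ^ (1 / α) * Real.sqrt ε * 2 := by
        rw [integral_const_mul]; gcongr
    _ = _ := by ring

/-- Hoeffding's lemma after truncation: if `|g| ≤ n X`, the exponential moment of `g` on the event
`X ≤ M` is that of a variable bounded by `n M` whose mean differs from that of `g` by at most `n`
times the mass of `X` beyond `M`. -/
lemma lintegral_indicator_exp_le [IsProbabilityMeasure ν] {g : Z → ℝ} (hg : Measurable g)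
    (hX : Measurable X) (hXint : Integrable X ν) {n M B : ℝ} (hn : 0 ≤ n) (hM : 0 ≤ M)
    (hgX : ∀ z, |g z| ≤ n * X z) (hB : ∫ z, {z | M < X z}.indicator X z ∂ν ≤ B)
    {s : ℝ} (hs : 0 ≤ s) :
    ∫⁻ z, {z | X z ≤ M}.indicator (fun z => ENNReal.ofReal (Real.exp (s * g z))) z ∂ν
      ≤ ENNReal.ofReal (Real.exp (s * (∫ z, g z ∂ν + n * B) + s ^ 2 * n ^ 2 * M ^ 2 / 2)) := by
  set A := {z | X z ≤ M} with hA
  have hAm : MeasurableSet A := measurableSet_le hX measurable_const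
  have hAc : Aᶜ = {z | M < X z} := by ext z; simp [hA]
  set Y := A.indicator g with hY
  have hYm : Measurable Y := hg.indicator hAm
  have hgint : Integrable g ν := (hXint.const_mul n).mono' hg.aestronglyMeasurable
    (Filter.Eventually.of_forall hgX)
  have hYb : ∀ z, Y z ∈ Set.Icc (-(n * M)) (n * M) := by
    intro z
    by_cases hz : z ∈ A
    · rw [hY, Set.indicator_of_mem hz, Set.mem_Icc, ← abs_le]
      exact (hgX z).trans (by gcongr; exact hz)
    · rw [hY, Set.indicator_of_notMem hz]
      constructor <;> nlinarith
  have hmean : ∫ z, Y z ∂ν ≤ ∫ z, g z ∂ν + n * B := by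
    have h1 : ∫ z, Y z ∂ν + ∫ z, Aᶜ.indicator g z ∂ν = ∫ z, g z ∂ν := by
      rw [← integral_add (hgint.indicator hAm) (hgint.indicator hAm.compl)]
      exact integral_congr_ae (Filter.Eventually.of_forall fun z =>
        congrFun (Set.indicator_self_add_compl A g) z)
    have h2 : -∫ z, Aᶜ.indicator g z ∂ν ≤ n * ∫ z, Aᶜ.indicator X z ∂ν := by
      rw [← integral_neg, ← integral_const_mul]
      refine integral_mono (hgint.indicator hAm.compl).neg
        ((hXint.indicator hAm.compl).const_mul n) fun z => ?_
      by_cases hz : z ∈ Aᶜ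
      · simp only [Set.indicator_of_mem hz]
        exact (neg_le_abs _).trans (hgX z)
      · simp [Set.indicator_of_notMem hz]
    rw [hAc] at h2
    have h3 := mul_le_mul_of_nonneg_left hB hn
    rw [← hAc] at h3 h2
    linarith
  have hsub := hasSubgaussianMGF_of_mem_Icc (μ := ν) hYm.aemeasurable
    (Filter.Eventually.of_forall hYb)
  have hmgf := hsub.mgf_le s
  have hc : ((((‖n * M - -(n * M)‖₊ / 2) ^ 2 : NNReal)) : ℝ) = n ^ 2 * M ^ 2 := by
    push_cast
    rw [Real.norm_eq_abs, div_pow, sq_abs]; ring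
  rw [hc] at hmgf
  have hexp : ∀ z, Real.exp (s * Y z)
      = Real.exp (s * ∫ z, Y z ∂ν) * Real.exp (s * (Y z - ∫ z, Y z ∂ν)) := by
    intro z; rw [← Real.exp_add]; congr 1; ring
  have hint : Integrable (fun z => Real.exp (s * Y z)) ν := by
    simp_rw [hexp]
    exact (hsub.integrable_exp_mul s).const_mul _
  calc _ ≤ ∫⁻ z, ENNReal.ofReal (Real.exp (s * Y z)) ∂ν := by
        refine lintegral_mono fun z => ?_
        by_cases hz : z ∈ A
        · rw [Set.indicator_of_mem hz, hY, Set.indicator_of_mem hz]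
        · rw [Set.indicator_of_notMem hz]; exact zero_le
    _ = ENNReal.ofReal (∫ z, Real.exp (s * Y z) ∂ν) :=
        (ofReal_integral_eq_lintegral_ofReal hint
          (Filter.Eventually.of_forall fun z => (Real.exp_pos _).le)).symm
    _ ≤ _ := by
        refine ENNReal.ofReal_le_ofReal ?_
        simp_rw [hexp]
        rw [integral_const_mul, Real.exp_add]
        refine mul_le_mul (Real.exp_le_exp.2 (by gcongr)) ?_ (integral_nonneg fun z =>
          (Real.exp_pos _).le) (Real.exp_pos _).le
        calc _ ≤ _ := hmgf
          _ = _ := by congr 1; ring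

end Tails

/-! ### Exponential moments along chains driven by i.i.d. samples -/

section Chain

variable {Ω Z S : Type*} [MeasurableSpace Z] [MeasurableSpace S]
  {ζ : ℕ → Ω → Z} {X : ℕ → Ω → S} {f : S → Z → S} {s₀ : S}

/-- The state of a chain driven by i.i.d. samples is a function of the samples already used. -/
lemma exists_measurable_history (hf : Measurable (Function.uncurry f))
    (hX0 : ∀ ω, X 0 ω = s₀) (hX : ∀ t ω, X (t + 1) ω = f (X t ω) (ζ t ω)) (t : ℕ) :
    ∃ g : (Finset.range t → Z) → S, Measurable g ∧
      ∀ ω, X t ω = g (fun i => ζ i ω) := by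
  induction t with
  | zero => exact ⟨fun _ => s₀, measurable_const, hX0⟩
  | succ t ih =>
    obtain ⟨g, hg, hgX⟩ := ih
    refine ⟨fun h => f (g fun i => h ⟨i, Finset.mem_range.2
      ((Finset.mem_range.1 i.2).trans (Nat.lt_succ_self t))⟩)
      (h ⟨t, Finset.mem_range.2 (Nat.lt_succ_self t)⟩), ?_, fun ω => by rw [hX, hgX]⟩
    refine hf.comp (Measurable.prodMk (hg.comp ?_) (measurable_pi_apply _))
    exact measurable_pi_lambda _ fun i => measurable_pi_apply _

variable [MeasurableSpace Ω] {P : Measure Ω} [IsProbabilityMeasure P]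
  {ν : Measure Z} [IsProbabilityMeasure ν]

lemma measurable_chain (hζ : ∀ t, Measurable (ζ t)) (hf : Measurable (Function.uncurry f))
    (hX0 : ∀ ω, X 0 ω = s₀) (hX : ∀ t ω, X (t + 1) ω = f (X t ω) (ζ t ω)) (t : ℕ) :
    Measurable (X t) := by
  obtain ⟨g, hg, hgX⟩ := exists_measurable_history hf hX0 hX t
  rw [funext hgX]
  exact hg.comp (measurable_pi_lambda _ fun i => hζ i)

/-- Integrating out the current sample, which is independent of the current state. -/
lemma lintegral_chain (hζ : ∀ t, Measurable (ζ t)) (hindep : iIndepFun ζ P)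
    (hlaw : ∀ t, Measure.map (ζ t) P = ν) (hf : Measurable (Function.uncurry f))
    (hX0 : ∀ ω, X 0 ω = s₀) (hX : ∀ t ω, X (t + 1) ω = f (X t ω) (ζ t ω)) (t : ℕ)
    {φ : S → Z → ENNReal} (hφ : Measurable (Function.uncurry φ)) :
    ∫⁻ ω, φ (X t ω) (ζ t ω) ∂P = ∫⁻ ω, ∫⁻ z, φ (X t ω) z ∂ν ∂P := by
  have hXm := measurable_chain hζ hf hX0 hX t
  have hind : IndepFun (X t) (ζ t) P := by
    obtain ⟨g, hg, hgX⟩ := exists_measurable_history hf hX0 hX t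
    have h := (hindep.indepFun_finset (Finset.range t) {t} (by simp) hζ).comp hg
      (measurable_pi_apply (⟨t, by simp⟩ : ({t} : Finset ℕ)))
    rw [funext hgX]
    exact h
  have hmap := (indepFun_iff_map_prod_eq_prod_map_map hXm.aemeasurable (hζ t).aemeasurable).1 hind
  rw [hlaw] at hmap
  calc _ = ∫⁻ y, Function.uncurry φ y ∂(Measure.map (fun ω => (X t ω, ζ t ω)) P) := by
        rw [lintegral_map hφ (hXm.prodMk (hζ t))]; rfl
    _ = ∫⁻ s, ∫⁻ z, φ s z ∂ν ∂(Measure.map (X t) P) := by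
        rw [hmap, lintegral_prod _ hφ.aemeasurable]; rfl
    _ = _ := lintegral_map hφ.lintegral_prod_right' hXm

/-- An exponential drift condition on the set `A` of good transitions bounds the exponential
moment of the potential along the chain as long as all transitions have been good. The condition
is used at the exponents `l * q ^ k`, one for each remaining step. -/
lemma lintegral_good_exp_le (hζ : ∀ t, Measurable (ζ t)) (hindep : iIndepFun ζ P)
    (hlaw : ∀ t, Measure.map (ζ t) P = ν) (hf : Measurable (Function.uncurry f))
    (hX0 : ∀ ω, X 0 ω = s₀) (hX : ∀ t ω, X (t + 1) ω = f (X t ω) (ζ t ω))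
    {A : Set (S × Z)} (hA : MeasurableSet A) {x : S → ℝ} (hx : Measurable x)
    {L q κ : ℝ} (hq0 : 0 ≤ q) (hq1 : q < 1) (hκ : 0 ≤ κ)
    (hdrift : ∀ l, 0 ≤ l → l ≤ L → ∀ s,
      ∫⁻ z, A.indicator (fun y => ENNReal.ofReal (Real.exp (l * x (f y.1 y.2)))) (s, z) ∂ν
        ≤ ENNReal.ofReal (Real.exp (l * (q * x s + κ)))) (t : ℕ) :
    ∀ l, 0 ≤ l → l ≤ L →
      ∫⁻ ω, {ω | ∀ i < t, (X i ω, ζ i ω) ∈ A}.indicator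
          (fun ω => ENNReal.ofReal (Real.exp (l * x (X t ω)))) ω ∂P
        ≤ ENNReal.ofReal (Real.exp (l * (q ^ t * x s₀ + κ / (1 - q)))) := by
  classical
  have hq : 0 < 1 - q := sub_pos.2 hq1
  -- the chain is enriched with the indicator of the event that all transitions were good
  let w : ℕ → Ω → ENNReal := fun t => {ω | ∀ i < t, (X i ω, ζ i ω) ∈ A}.indicator 1
  have hw0 : ∀ ω, w 0 ω = 1 := fun ω => by simp [w]
  have hws : ∀ t ω, w (t + 1) ω = w t ω * A.indicator 1 (X t ω, ζ t ω) := by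
    intro t ω
    simp only [w, Set.indicator_apply, Set.mem_ofPred_eq, Nat.forall_lt_succ_right, Pi.one_apply]
    split_ifs <;> simp_all
  let f' : S × ENNReal → Z → S × ENNReal := fun y z =>
    (f y.1 z, y.2 * A.indicator 1 (y.1, z))
  have hf'm : Measurable (Function.uncurry f') := by
    have h1 : Measurable fun y : (S × ENNReal) × Z => (y.1.1, y.2) := by fun_prop
    refine Measurable.prodMk (hf.comp h1) (Measurable.mul (by fun_prop) ?_)
    exact (measurable_one.indicator hA).comp h1
  have hX' : ∀ t ω, (X (t + 1) ω, w (t + 1) ω) = f' (X t ω, w t ω) (ζ t ω) := by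
    intro t ω; simp only [f', hX, hws]
  have hX0' : ∀ ω, (X 0 ω, w 0 ω) = (s₀, 1) := fun ω => by rw [hX0, hw0]
  have hind : ∀ t l ω, {ω | ∀ i < t, (X i ω, ζ i ω) ∈ A}.indicator
      (fun ω => ENNReal.ofReal (Real.exp (l * x (X t ω)))) ω
        = w t ω * ENNReal.ofReal (Real.exp (l * x (X t ω))) := by
    intro t l ω
    simp only [w, Set.indicator_apply]
    split_ifs <;> simp
  simp_rw [hind]
  induction t with
  | zero =>
    intro l hl _
    simp only [hw0, hX0, one_mul, lintegral_const, measure_univ, mul_one, pow_zero]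
    refine ENNReal.ofReal_le_ofReal (Real.exp_le_exp.2 ?_)
    gcongr
    have : 0 ≤ κ / (1 - q) := by positivity
    linarith
  | succ t ih =>
    intro l hl hlL
    set φ : S × ENNReal → Z → ENNReal := fun y z => y.2 *
      A.indicator (fun y => ENNReal.ofReal (Real.exp (l * x (f y.1 y.2)))) (y.1, z) with hφ
    have hin : Measurable (A.indicator fun y : S × Z =>
        ENNReal.ofReal (Real.exp (l * x (f y.1 y.2)))) := by
      refine Measurable.indicator ?_ hA
      have : Measurable fun y : S × Z => x (f y.1 y.2) := hx.comp hf
      fun_prop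
    have hφm : Measurable (Function.uncurry φ) := by
      have h1 : Measurable fun y : (S × ENNReal) × Z => (y.1.1, y.2) := by fun_prop
      exact Measurable.mul (by fun_prop) (hin.comp h1)
    have hlq : l * q ≤ L := (mul_le_of_le_one_right hl hq1.le).trans hlL
    calc ∫⁻ ω, w (t + 1) ω * ENNReal.ofReal (Real.exp (l * x (X (t + 1) ω))) ∂P
        = ∫⁻ ω, φ (X t ω, w t ω) (ζ t ω) ∂P := by
          refine lintegral_congr fun ω => ?_
          simp only [hφ, hX, hws, Set.indicator_apply]
          split_ifs <;> simp
      _ = ∫⁻ ω, ∫⁻ z, φ (X t ω, w t ω) z ∂ν ∂P :=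
          lintegral_chain (X := fun t ω => (X t ω, w t ω)) hζ hindep hlaw hf'm hX0' hX' t hφm
      _ ≤ ∫⁻ ω, ENNReal.ofReal (Real.exp (l * κ)) *
            (w t ω * ENNReal.ofReal (Real.exp (l * q * x (X t ω)))) ∂P := by
          refine lintegral_mono fun ω => ?_
          simp only [hφ]
          have hin' : Measurable fun z => A.indicator
              (fun y => ENNReal.ofReal (Real.exp (l * x (f y.1 y.2)))) (X t ω, z) :=
            hin.comp measurable_prodMk_left
          rw [lintegral_const_mul _ hin']
          calc _ ≤ w t ω * ENNReal.ofReal (Real.exp (l * (q * x (X t ω) + κ))) := by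
                gcongr
                exact hdrift l hl hlL _
            _ = _ := by
                rw [mul_left_comm, ← ENNReal.ofReal_mul (Real.exp_pos _).le, ← Real.exp_add]
                congr 3
                ring
      _ ≤ ENNReal.ofReal (Real.exp (l * κ)) *
            ENNReal.ofReal (Real.exp (l * q * (q ^ t * x s₀ + κ / (1 - q)))) := by
          rw [lintegral_const_mul' _ _ ENNReal.ofReal_ne_top]
          gcongr
          exact ih (l * q) (by positivity) hlq
      _ = _ := by
          rw [← ENNReal.ofReal_mul (Real.exp_pos _).le, ← Real.exp_add]
          congr 2
          field_simp
          ring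

lemma measurableSet_good (hζ : ∀ t, Measurable (ζ t)) (hXm : ∀ t, Measurable (X t))
    {A : Set (S × Z)} (hA : MeasurableSet A) (t : ℕ) :
    MeasurableSet {ω | ∀ i < t, (X i ω, ζ i ω) ∈ A} := by
  simp only [Set.ofPred_forall]
  exact MeasurableSet.iInter fun i => MeasurableSet.iInter fun _ =>
    ((hXm i).prodMk (hζ i)) hA

/-- Markov's inequality for `lintegral_good_exp_le`. -/
lemma measure_good_inter_lt_le (hζ : ∀ t, Measurable (ζ t)) (hindep : iIndepFun ζ P)
    (hlaw : ∀ t, Measure.map (ζ t) P = ν) (hf : Measurable (Function.uncurry f))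
    (hX0 : ∀ ω, X 0 ω = s₀) (hX : ∀ t ω, X (t + 1) ω = f (X t ω) (ζ t ω))
    {A : Set (S × Z)} (hA : MeasurableSet A) {x : S → ℝ} (hx : Measurable x)
    {L q κ : ℝ} (hL : 0 ≤ L) (hq0 : 0 ≤ q) (hq1 : q < 1) (hκ : 0 ≤ κ)
    (hdrift : ∀ l, 0 ≤ l → l ≤ L → ∀ s,
      ∫⁻ z, A.indicator (fun y => ENNReal.ofReal (Real.exp (l * x (f y.1 y.2)))) (s, z) ∂ν
        ≤ ENNReal.ofReal (Real.exp (l * (q * x s + κ)))) (t : ℕ) (a : ℝ) :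
    P ({ω | ∀ i < t, (X i ω, ζ i ω) ∈ A} ∩ {ω | a < x (X t ω)})
      ≤ ENNReal.ofReal (Real.exp (-(L * (a - q ^ t * x s₀ - κ / (1 - q))))) := by
  have hXm := measurable_chain hζ hf hX0 hX
  have hG := measurableSet_good hζ hXm hA t
  have hmain := lintegral_good_exp_le hζ hindep hlaw hf hX0 hX hA hx hq0 hq1 hκ hdrift t L hL le_rfl
  have hxm : Measurable fun ω => x (X t ω) := hx.comp (hXm t)
  have hm : Measurable ({ω | ∀ i < t, (X i ω, ζ i ω) ∈ A}.indicator
      fun ω => ENNReal.ofReal (Real.exp (L * x (X t ω)))) :=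
    Measurable.indicator (by fun_prop) hG
  have h1 := (mul_meas_ge_le_lintegral hm (ENNReal.ofReal (Real.exp (L * a))) (μ := P)).trans hmain
  set B := {ω | ENNReal.ofReal (Real.exp (L * a)) ≤ ({ω | ∀ i < t, (X i ω, ζ i ω) ∈ A}.indicator
      fun ω => ENNReal.ofReal (Real.exp (L * x (X t ω)))) ω}
  have h2 : P ({ω | ∀ i < t, (X i ω, ζ i ω) ∈ A} ∩ {ω | a < x (X t ω)}) ≤ P B := by
    refine measure_mono fun ω hω => ?_
    change ENNReal.ofReal (Real.exp (L * a)) ≤ Set.indicator _ _ ω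
    rw [Set.indicator_of_mem hω.1]
    refine ENNReal.ofReal_le_ofReal (Real.exp_le_exp.2 ?_)
    have : a < x (X t ω) := hω.2
    gcongr
  calc _ ≤ P B := h2
    _ = ENNReal.ofReal (Real.exp (-(L * a))) * (ENNReal.ofReal (Real.exp (L * a)) * P B) := by
        rw [← mul_assoc, ← ENNReal.ofReal_mul (Real.exp_pos _).le, ← Real.exp_add]
        simp
    _ ≤ ENNReal.ofReal (Real.exp (-(L * a))) *
          ENNReal.ofReal (Real.exp (L * (q ^ t * x s₀ + κ / (1 - q)))) := by gcongr
    _ = _ := by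
        rw [← ENNReal.ofReal_mul (Real.exp_pos _).le, ← Real.exp_add]
        congr 2
        ring

end Chain

/-! ### Exponential drift of the squared distance -/

/-- The transitions along which the drift estimate is available: the iterate is within squared
distance `2 r²` of `vs` (for a start within `r²`, the gap `r²` makes an exit unlikely), and the
stochastic gradient is at most the truncation level `M`. -/
def goodSteps {Z : Type*} (Γ : EuclideanSpace ℝ (Fin d) → Z → EuclideanSpace ℝ (Fin d))
    (vs : EuclideanSpace ℝ (Fin d)) (r M : ℝ) : Set (EuclideanSpace ℝ (Fin d) × Z) :=
  {y | ‖y.1‖ = 1 ∧ ‖y.1 - vs‖ ^ 2 ≤ 2 * r ^ 2 ∧ ‖Γ y.1 y.2‖ ≤ M}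

lemma measurableSet_goodSteps {Z : Type*} [MeasurableSpace Z]
    {Γ : EuclideanSpace ℝ (Fin d) → Z → EuclideanSpace ℝ (Fin d)}
    (hΓ : Measurable (Function.uncurry Γ)) (vs : EuclideanSpace ℝ (Fin d)) (r M : ℝ) :
    MeasurableSet (goodSteps Γ vs r M) := by
  have h1 : Measurable fun y : EuclideanSpace ℝ (Fin d) × Z => ‖y.1‖ := by fun_prop
  have h2 : Measurable fun y : EuclideanSpace ℝ (Fin d) × Z => ‖y.1 - vs‖ ^ 2 := by fun_prop
  have h3 : Measurable fun y : EuclideanSpace ℝ (Fin d) × Z => ‖Γ y.1 y.2‖ := hΓ.norm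
  exact (measurableSet_eq_fun h1 measurable_const).inter
    ((measurableSet_le h2 measurable_const).inter (measurableSet_le h3 measurable_const))

/-- Exponential drift of the squared distance over one good step. Of the contraction
`1.6 D μ η` supplied by the mean, `0.3 D μ η` pays for the truncation bias and `0.3 D μ η` for
Hoeffding's quadratic term, whose size is proportional to the squared distance itself. -/
lemma lintegral_goodSteps_exp_le {Z : Type*} [MeasurableSpace Z]
    {ν : Measure Z} [IsProbabilityMeasure ν] {F D : EuclideanSpace ℝ (Fin d) → ℝ}
    {Γ : EuclideanSpace ℝ (Fin d) → Z → EuclideanSpace ℝ (Fin d)}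
    (hΓ_meas : Measurable (Function.uncurry Γ))
    (hΓ_int : ∀ v : EuclideanSpace ℝ (Fin d), ‖v‖ = 1 → Integrable (Γ v) ν)
    (hΓ_mean : ∀ v : EuclideanSpace ℝ (Fin d), ‖v‖ = 1 →
      ∫ z, Γ v z ∂ν = D v • gradient F v)
    {vs : EuclideanSpace ℝ (Fin d)} (hvs : ‖vs‖ = 1)
    (hmin : IsLocalMinOn F (Metric.sphere 0 1) vs) (hDpos : 0 < D vs) {μ : ℝ} (hμ : 0 < μ)
    (hμ_hess : ∀ u : EuclideanSpace ℝ (Fin d), inner ℝ u vs = 0 → ‖u‖ = 1 →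
      μ ≤ inner ℝ u (manifoldHessian F vs u))
    {δ L_D L_F L_K L_Q : ℝ} (hδ : 0 < δ) (hδ_one : δ ≤ 1)
    (hs : Smoothness D F vs δ L_D L_F L_K L_Q)
    {Pr : EuclideanSpace ℝ (Fin d) → EuclideanSpace ℝ (Fin d)} (hPr : IsSphereProjection Pr)
    {η M B r : ℝ} (hη : 0 < η) (hM : 0 < M) (hr : 0 ≤ r) (hηM : η * M ≤ 1 / 2)
    (hB : ∀ v : EuclideanSpace ℝ (Fin d), ‖v‖ = 1 →
      ∫ z, {z | M < ‖Γ v z‖}.indicator (fun z => ‖Γ v z‖) z ∂ν ≤ B)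
    (hrδ : r ≤ δ / 2) (hrρ : rho (D vs) L_D L_F L_K L_Q * r ≤ D vs * μ / 32)
    {l : ℝ} (hl : 0 ≤ l) (hlL : l ≤ 3 / 20 * (D vs * μ) / (η * M ^ 2))
    (v : EuclideanSpace ℝ (Fin d)) :
    ∫⁻ z, (goodSteps Γ vs r M).indicator
        (fun y => ENNReal.ofReal (Real.exp (l * ‖Pr (y.1 - η • Γ y.1 y.2) - vs‖ ^ 2))) (v, z) ∂ν
      ≤ ENNReal.ofReal (Real.exp (l * ((1 - D vs * μ * η) * ‖v - vs‖ ^ 2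
          + (4 * η ^ 2 * M ^ 2 + η * (B ^ 2 / (3 / 10 * (D vs * μ))))))) := by
  by_cases hv : ‖v‖ = 1 ∧ ‖v - vs‖ ^ 2 ≤ 2 * r ^ 2
  swap
  · have : ∀ z, (v, z) ∉ goodSteps Γ vs r M := fun z hz => hv ⟨hz.1, hz.2.1⟩
    simp [Set.indicator_of_notMem (this _)]
  obtain ⟨hv1, hvr⟩ := hv
  have hDμ : 0 < D vs * μ := mul_pos hDpos hμ
  set n := ‖v - vs‖ with hn
  have hn0 : 0 ≤ n := norm_nonneg _
  have hnr : n ≤ 3 / 2 * r := le_of_sq_le_sq (by nlinarith) (by positivity)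
  have hnδ : n ≤ δ := le_of_sq_le_sq (by nlinarith) hδ.le
  have hn2 : n ^ 2 ≤ 1 / 2 := by nlinarith
  set c : ℝ := inner ℝ v vs with hcdef
  have hc : c = 1 - n ^ 2 / 2 := by
    rw [hn, norm_sub_sq_real, hv1, hvs]; ring
  set p := vs - c • v with hp
  have hpn : ‖p‖ ≤ n := by
    refine le_of_sq_le_sq ?_ hn0
    rw [hp, norm_sub_sq_real, real_inner_smul_right, norm_smul, hv1, hvs, real_inner_comm,
      ← hcdef, mul_one, Real.norm_eq_abs, sq_abs, hc]
    nlinarith [sq_nonneg (n ^ 2)]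
  have hΓv : Measurable (Γ v) := hΓ_meas.comp measurable_prodMk_left
  have hdrift : ∫ z, inner ℝ (Γ v z) p ∂ν ≤ -(4 / 5 * (D vs * μ) * n ^ 2) := by
    have h1 : ∫ z, inner ℝ (Γ v z) p ∂ν = D v * inner ℝ (gradient F v) p := by
      simp_rw [fun z => real_inner_comm p (Γ v z)]
      rw [integral_inner (hΓ_int v hv1), hΓ_mean v hv1, real_inner_smul_right, real_inner_comm]
    rw [h1]
    have h2 := hs.drift_le hvs hδ hδ_one hDpos hmin hμ_hess hv1 hnδ
    refine h2.trans ?_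
    have hρn : rho (D vs) L_D L_F L_K L_Q * n ≤ D vs * μ / 20 := by
      have hρ0 : 0 ≤ rho (D vs) L_D L_F L_K L_Q := by
        have := hs.pos_D; have := hs.pos_F; have := hs.pos_K; have := hs.pos_Q
        unfold rho; positivity
      have := mul_le_mul_of_nonneg_left hnr hρ0
      linarith
    have h3 := mul_le_mul_of_nonneg_right hρn (sq_nonneg n)
    have h4 : D vs * μ * (n ^ 2 * n ^ 2) ≤ D vs * μ * (n ^ 2 * (1 / 2)) := by gcongr
    have h5 : 0 ≤ D vs * μ * n ^ 2 := by positivity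
    rw [← hn]
    nlinarith
  have hHoeff := lintegral_indicator_exp_le (ν := ν) (g := fun z => inner ℝ (Γ v z) p)
    (X := fun z => ‖Γ v z‖) (by fun_prop) hΓv.norm (hΓ_int v hv1).norm hn0 hM.le
    (fun z => (abs_real_inner_le_norm _ _).trans (by rw [mul_comm]; gcongr)) (hB v hv1)
    (s := 2 * η * l) (by positivity)
  calc _ ≤ ∫⁻ z, ENNReal.ofReal (Real.exp (l * (n ^ 2 + 4 * (η * M) ^ 2))) *
        {z | ‖Γ v z‖ ≤ M}.indicator
          (fun z => ENNReal.ofReal (Real.exp (2 * η * l * inner ℝ (Γ v z) p))) z ∂ν := by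
        refine lintegral_mono fun z => ?_
        by_cases hz : (v, z) ∈ goodSteps Γ vs r M
        · have hzM : z ∈ {z | ‖Γ v z‖ ≤ M} := hz.2.2
          rw [Set.indicator_of_mem hz, Set.indicator_of_mem hzM,
            ← ENNReal.ofReal_mul (Real.exp_pos _).le, ← Real.exp_add]
          refine ENNReal.ofReal_le_ofReal (Real.exp_le_exp.2 ?_)
          have hstep := hPr.norm_sub_sq_le (h := η • Γ v z) (m := η * M) hv1 hvs
            (by rw [norm_smul, Real.norm_eq_abs, abs_of_pos hη]
                exact mul_le_mul_of_nonneg_left hzM hη.le) hηM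
            (by rw [← hcdef, hc]; linarith)
          rw [real_inner_smul_left, ← hcdef, ← hp, ← hn] at hstep
          have := mul_le_mul_of_nonneg_left hstep hl
          dsimp only
          linarith
        · rw [Set.indicator_of_notMem hz]; exact zero_le
    _ ≤ ENNReal.ofReal (Real.exp (l * (n ^ 2 + 4 * (η * M) ^ 2))) *
          ENNReal.ofReal (Real.exp (2 * η * l * (∫ z, inner ℝ (Γ v z) p ∂ν + n * B)
            + (2 * η * l) ^ 2 * n ^ 2 * M ^ 2 / 2)) := by
        rw [lintegral_const_mul' _ _ ENNReal.ofReal_ne_top]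
        gcongr
    _ ≤ _ := by
        rw [← ENNReal.ofReal_mul (Real.exp_pos _).le, ← Real.exp_add]
        refine ENNReal.ofReal_le_ofReal (Real.exp_le_exp.2 ?_)
        have h1 : 2 * η * l * (∫ z, inner ℝ (Γ v z) p ∂ν + n * B)
            ≤ 2 * η * l * (-(4 / 5 * (D vs * μ) * n ^ 2) + n * B) := by gcongr
        have h2 : 2 * (n * B) ≤ 3 / 10 * (D vs * μ) * n ^ 2 + B ^ 2 / (3 / 10 * (D vs * μ)) := by
          have h := div_nonneg (sq_nonneg (3 / 10 * (D vs * μ) * n - B))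
            (by positivity : 0 ≤ 3 / 10 * (D vs * μ))
          have e : (3 / 10 * (D vs * μ) * n - B) ^ 2 / (3 / 10 * (D vs * μ))
              = 3 / 10 * (D vs * μ) * n ^ 2 - 2 * (n * B) + B ^ 2 / (3 / 10 * (D vs * μ)) := by
            field_simp
            ring
          linarith
        have h2' := mul_le_mul_of_nonneg_left h2 (by positivity : 0 ≤ η * l)
        rw [le_div_iff₀ (by positivity)] at hlL
        have h3 := mul_le_mul_of_nonneg_left hlL (by positivity : 0 ≤ 2 * η * l * n ^ 2)
        linarith

/-! ### Union bound, the constant `G`, and the round length -/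

/-- The union bound over the first bad transition and over the final time window. A transition is
bad because the potential has left its allowed range or, within that range, because of the
sample alone. -/
lemma exists_event_of_step_bounds {Ω Z S : Type*} [MeasurableSpace Ω] [MeasurableSpace Z]
    [MeasurableSpace S] {P : Measure Ω} [IsProbabilityMeasure P] {ζ : ℕ → Ω → Z} {X : ℕ → Ω → S}
    (hζ : ∀ t, Measurable (ζ t)) (hXm : ∀ t, Measurable (X t)) {A : Set (S × Z)}
    (hA : MeasurableSet A) {x : S → ℝ} (hx : Measurable x) {a b ε : ℝ} (hε : 0 ≤ ε) {N T : ℕ}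
    (hN : 1 ≤ N)
    (hnoise : ∀ t, P {ω | x (X t ω) ≤ a ∧ (X t ω, ζ t ω) ∉ A} ≤ ENNReal.ofReal (2 * ε))
    (hexit : ∀ t, P ({ω | ∀ i < t, (X i ω, ζ i ω) ∈ A} ∩ {ω | a < x (X t ω)})
      ≤ ENNReal.ofReal ε)
    (hfin : ∀ t, N ≤ t → P ({ω | ∀ i < t, (X i ω, ζ i ω) ∈ A} ∩ {ω | b < x (X t ω)})
      ≤ ENNReal.ofReal ε) :
    ∃ H : Set Ω, MeasurableSet H ∧ 1 - 4 * T * ε ≤ P.real H ∧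
      ∀ ω ∈ H, ∀ t, N ≤ t → t ≤ T → x (X t ω) ≤ b := by
  classical
  set H : Set Ω := {ω | ∀ i < T, (X i ω, ζ i ω) ∈ A} ∩ {ω | ∀ t ∈ Finset.Icc N T, x (X t ω) ≤ b}
    with hH
  have hHm : MeasurableSet H := by
    refine (measurableSet_good hζ hXm hA T).inter ?_
    simp only [Set.ofPred_forall]
    exact MeasurableSet.iInter fun t => MeasurableSet.iInter fun _ =>
      measurableSet_le (hx.comp (hXm t)) measurable_const
  refine ⟨H, hHm, ?_, fun ω hω t h1 h2 => hω.2 t (Finset.mem_Icc.2 ⟨h1, h2⟩)⟩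
  have hcover : Hᶜ ⊆ (⋃ t ∈ Finset.range T, {ω | x (X t ω) ≤ a ∧ (X t ω, ζ t ω) ∉ A}) ∪
      (⋃ t ∈ Finset.range T, {ω | ∀ i < t, (X i ω, ζ i ω) ∈ A} ∩ {ω | a < x (X t ω)}) ∪
      (⋃ t ∈ Finset.Icc N T, {ω | ∀ i < t, (X i ω, ζ i ω) ∈ A} ∩ {ω | b < x (X t ω)}) := by
    intro ω hω
    by_cases hgood : ∀ i < T, (X i ω, ζ i ω) ∈ A
    · have : ¬ ∀ t ∈ Finset.Icc N T, x (X t ω) ≤ b := fun h => hω ⟨hgood, h⟩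
      push Not at this
      obtain ⟨t, ht, hbt⟩ := this
      refine Or.inr (Set.mem_biUnion ht ⟨fun i hi => hgood i ?_, hbt⟩)
      exact hi.trans_le (Finset.mem_Icc.1 ht).2
    · push Not at hgood
      obtain ⟨hlt, hbad⟩ := Nat.find_spec hgood
      have hmin : ∀ i < Nat.find hgood, (X i ω, ζ i ω) ∈ A := fun i hi => by
        have := Nat.find_min hgood hi
        push Not at this
        exact this (hi.trans hlt)
      refine Or.inl ?_
      rcases le_or_gt (x (X (Nat.find hgood) ω)) a with hle | hgt
      · exact Or.inl (Set.mem_biUnion (Finset.mem_coe.2 (Finset.mem_range.2 hlt)) ⟨hle, hbad⟩)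
      · exact Or.inr (Set.mem_biUnion (Finset.mem_coe.2 (Finset.mem_range.2 hlt)) ⟨hmin, hgt⟩)
  have hbound : P Hᶜ ≤ ENNReal.ofReal (4 * T * ε) := by
    have e1 := (measure_biUnion_finset_le (μ := P) (Finset.range T)
      fun t => {ω | x (X t ω) ≤ a ∧ (X t ω, ζ t ω) ∉ A}).trans
      (Finset.sum_le_sum fun t _ => hnoise t)
    have e2 := (measure_biUnion_finset_le (μ := P) (Finset.range T)
      fun t => {ω | ∀ i < t, (X i ω, ζ i ω) ∈ A} ∩ {ω | a < x (X t ω)}).trans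
      (Finset.sum_le_sum fun t _ => hexit t)
    have e3 := (measure_biUnion_finset_le (μ := P) (Finset.Icc N T)
      fun t => {ω | ∀ i < t, (X i ω, ζ i ω) ∈ A} ∩ {ω | b < x (X t ω)}).trans
      (Finset.sum_le_sum fun t ht => hfin t (Finset.mem_Icc.1 ht).1)
    simp only [Finset.sum_const, Finset.card_range, Nat.card_Icc, nsmul_eq_mul] at e1 e2 e3
    have hcard : ((T + 1 - N : ℕ) : ENNReal) ≤ T := by
      exact_mod_cast (by omega : T + 1 - N ≤ T)
    calc P Hᶜ ≤ _ := measure_mono hcover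
      _ ≤ _ := measure_union_le _ _
      _ ≤ _ := add_le_add_left (measure_union_le _ _) _
      _ ≤ (T * ENNReal.ofReal (2 * ε) + T * ENNReal.ofReal ε) + T * ENNReal.ofReal ε := by
          gcongr
          exact e3.trans (by gcongr)
      _ = ENNReal.ofReal (4 * T * ε) := by
          rw [← ENNReal.ofReal_natCast, ← ENNReal.ofReal_mul (by positivity),
            ← ENNReal.ofReal_mul (by positivity), ← ENNReal.ofReal_add (by positivity)
            (by positivity), ← ENNReal.ofReal_add (by positivity) (by positivity)]
          congr 1
          ring
  have h1 : P.real H = 1 - P.real Hᶜ := by rw [probReal_compl_eq_one_sub hHm]; ring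
  have h2 : P.real Hᶜ ≤ 4 * T * ε := ENNReal.toReal_le_of_le_ofReal (by positivity) hbound
  linarith

lemma one_le_G {α : ℝ} (hα : 0 < α) : 1 ≤ G α := by
  have h : 1 ≤ Real.logb 2 (1 + Real.exp (1 / α)) := by
    rw [Real.le_logb_iff_rpow_le one_lt_two (by positivity), Real.rpow_one]
    have := Real.one_le_exp (one_div_pos.2 hα).le
    linarith
  have h1 := Real.one_le_rpow h (one_div_pos.2 hα).le
  unfold G
  nlinarith

/-- `G α` dominates the growth of the moments of an `α`-sub-Weibull variable. -/
lemma rpow_one_div_le_G {α : ℝ} (hα : 0 < α) : (1 / α) ^ (1 / α) ≤ G α := by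
  have hp : 0 < 1 / α := one_div_pos.2 hα
  have h : 1 / α ≤ Real.logb 2 (1 + Real.exp (1 / α)) := by
    rw [Real.le_logb_iff_rpow_le one_lt_two (by positivity), Real.rpow_def_of_pos two_pos]
    have h2 : Real.log 2 * (1 / α) ≤ 1 / α := by
      have := Real.log_two_lt_d9
      exact mul_le_of_le_one_left hp.le (by linarith)
    have := Real.exp_le_exp.2 h2
    linarith
  have h1 : (1 / α) ^ (1 / α) ≤ Real.logb 2 (1 + Real.exp (1 / α)) ^ (1 / α) := by gcongr
  refine h1.trans ?_
  have h2 : 0 ≤ Real.logb 2 (1 + Real.exp (1 / α)) ^ (1 / α) :=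
    Real.rpow_nonneg (hp.le.trans h) _
  unfold G
  nlinarith

section RoundLength

variable {Ds μ η : ℝ}

lemma one_le_Tstar (hy : 0 < Ds * μ * η) (hy1 : Ds * μ * η < 1) : 1 ≤ Tstar Ds μ η := by
  have h : 0 < -Real.log (1 - Ds * μ * η) :=
    neg_pos.2 (Real.log_neg (by linarith) (by linarith))
  have := Real.log_pos one_lt_two
  exact Nat.one_le_ceil_iff.2 (by positivity)

/-- One round multiplies the squared distance by at most `1 / 4`. -/
lemma pow_Tstar_le (hy : 0 < Ds * μ * η) (hy1 : Ds * μ * η < 1) :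
    (1 - Ds * μ * η) ^ Tstar Ds μ η ≤ 1 / 4 := by
  have h0 : 0 < 1 - Ds * μ * η := by linarith
  have h : 0 < -Real.log (1 - Ds * μ * η) := neg_pos.2 (Real.log_neg h0 (by linarith))
  have h1 : 2 * Real.log 2 / (-Real.log (1 - Ds * μ * η)) ≤ Tstar Ds μ η := Nat.le_ceil _
  rw [div_le_iff₀ h] at h1
  rw [← Real.log_le_log_iff (by positivity) (by norm_num), Real.log_pow]
  have h4 : Real.log (1 / 4) = -(2 * Real.log 2) := by
    rw [one_div, Real.log_inv, show (4 : ℝ) = 2 ^ 2 by norm_num, Real.log_pow]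
    norm_num
  rw [h4]
  linarith

/-- A failure probability that is informative over a single round is at most of the order of the
contraction rate. -/
lemma le_rate_of_Tstar_mul_lt (hy : 0 < Ds * μ * η) (hy1 : Ds * μ * η < 1) {ε : ℝ} (hε : 0 < ε)
    (hT : 14 * Tstar Ds μ η * ε < 1) : 7 * ε ≤ Ds * μ * η := by
  set y := Ds * μ * η with hydef
  rcases le_or_gt (1 / 2) y with hy2 | hy2
  · have h1 : (1 : ℝ) ≤ Tstar Ds μ η := by exact_mod_cast one_le_Tstar hy hy1
    nlinarith
  · have h0 : 0 < 1 - y := by linarith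
    have h : 0 < -Real.log (1 - y) := neg_pos.2 (Real.log_neg h0 (by linarith))
    have h1 : 2 * Real.log 2 / (-Real.log (1 - y)) ≤ Tstar Ds μ η := Nat.le_ceil _
    have h2 : -Real.log (1 - y) ≤ 2 * y := by
      have := Real.one_sub_inv_le_log_of_pos h0
      have h3 : (1 - y)⁻¹ ≤ 1 + 2 * y := by
        rw [inv_le_iff_one_le_mul₀ h0]
        nlinarith
      linarith
    have h3 : (1 / 2 : ℝ) ≤ Real.log 2 := by have := Real.log_two_gt_d9; linarith
    have h4 : 1 / (2 * y) ≤ Tstar Ds μ η := by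
      refine le_trans ?_ h1
      gcongr
      linarith
    rw [div_le_iff₀ (by positivity)] at h4
    have h5 := mul_le_mul_of_nonneg_left h4 hε.le
    nlinarith

end RoundLength

/-! ### Constants and the proof of local convergence -/

lemma rpow_half_exponent_sq {l : ℝ} (α : ℝ) (hl : 0 ≤ l) :
    (l ^ ((α + 2) / (2 * α))) ^ 2 = l ^ ((α + 2) / α) := by
  rw [← Real.rpow_natCast, ← Real.rpow_mul hl]
  congr 1
  push_cast
  rw [mul_comm 2 α, ← div_div, div_mul_cancel₀ _ two_ne_zero]

/-- After `K` rounds, each gaining a factor `1 / 4`, the squared warm-start distance is below the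
stationary variance level. -/
lemma sq_mul_pow_K_le {Ds μ ρ V α η ε : ℝ} (hDs : 0 < Ds) (hμ : 0 < μ) (hρ : 0 < ρ) (hV : 0 < V)
    (hη : 0 < η) (hl : 0 < Real.log ε⁻¹) :
    (Ds * μ / (2 ^ 5 * ρ)) ^ 2 * (1 / 4) ^ K Ds μ ρ V α η ε
      ≤ V ^ 2 * (Real.log ε⁻¹) ^ ((α + 2) / α) * η / (Ds * μ) / 4 := by
  set a := Real.sqrt (Ds ^ 3 * μ ^ 3) /
    (2 ^ 5 * ρ * V * (Real.log ε⁻¹) ^ ((α + 2) / (2 * α)) * η ^ (1 / 2 : ℝ)) with ha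
  have ha0 : 0 < a := by positivity
  have hlsq := rpow_half_exponent_sq α hl.le
  have hηsq : (η ^ (1 / 2 : ℝ)) ^ 2 = η := by
    rw [← Real.sqrt_eq_rpow, Real.sq_sqrt hη.le]
  have hasq : a ^ 2 = Ds ^ 3 * μ ^ 3 /
      (2 ^ 10 * ρ ^ 2 * V ^ 2 * (Real.log ε⁻¹) ^ ((α + 2) / α) * η) := by
    rw [ha, div_pow, Real.sq_sqrt (by positivity)]
    simp only [mul_pow]
    rw [hlsq, hηsq]
    norm_num
  have h2K : a * 2 ≤ 2 ^ K Ds μ ρ V α η ε := by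
    unfold K
    rw [pow_succ]
    gcongr
    calc a = 2 ^ Real.logb 2 a := (Real.rpow_logb two_pos (by norm_num) ha0).symm
      _ ≤ 2 ^ ((⌈Real.logb 2 a⌉₊ : ℕ) : ℝ) :=
        Real.rpow_le_rpow_of_exponent_le one_le_two (Nat.le_ceil _)
      _ = _ := Real.rpow_natCast _ _
  have h4K : (1 / 4 : ℝ) ^ K Ds μ ρ V α η ε ≤ 1 / (4 * a ^ 2) := by
    rw [one_div_pow]
    refine one_div_le_one_div_of_le (by positivity) ?_
    calc 4 * a ^ 2 = (a * 2) ^ 2 := by ring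
      _ ≤ (2 ^ K Ds μ ρ V α η ε) ^ 2 := by gcongr
      _ = 4 ^ K Ds μ ρ V α η ε := by rw [← pow_mul, mul_comm, pow_mul]; norm_num
  calc _ ≤ (Ds * μ / (2 ^ 5 * ρ)) ^ 2 * (1 / (4 * a ^ 2)) := by gcongr
    _ = _ := by
      rw [hasq]
      field_simp

/-- Within the allowed range, a step can only be bad because its stochastic gradient exceeds the
truncation level. -/
lemma measure_notMem_goodSteps_le {Ω Z : Type*} [MeasurableSpace Ω] [MeasurableSpace Z]
    {P : Measure Ω} [IsProbabilityMeasure P] {ν : Measure Z} [IsProbabilityMeasure ν]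
    {ζ : ℕ → Ω → Z} (hζ : ∀ t, Measurable (ζ t)) (hindep : iIndepFun ζ P)
    (hlaw : ∀ t, Measure.map (ζ t) P = ν)
    {Γ : EuclideanSpace ℝ (Fin d) → Z → EuclideanSpace ℝ (Fin d)}
    (hΓ : Measurable (Function.uncurry Γ))
    {X : ℕ → Ω → EuclideanSpace ℝ (Fin d)} {v₀ vs : EuclideanSpace ℝ (Fin d)}
    {f : EuclideanSpace ℝ (Fin d) → Z → EuclideanSpace ℝ (Fin d)}
    (hf : Measurable (Function.uncurry f)) (hX0 : ∀ ω, X 0 ω = v₀)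
    (hX : ∀ t ω, X (t + 1) ω = f (X t ω) (ζ t ω)) (hunit : ∀ t ω, ‖X t ω‖ = 1) {r M β : ℝ}
    (htail : ∀ v : EuclideanSpace ℝ (Fin d), ‖v‖ = 1 →
      ν {z | M < ‖Γ v z‖} ≤ ENNReal.ofReal β) (t : ℕ) :
    P {ω | ‖X t ω - vs‖ ^ 2 ≤ 2 * r ^ 2 ∧ (X t ω, ζ t ω) ∉ goodSteps Γ vs r M}
      ≤ ENNReal.ofReal β := by
  set C : Set (EuclideanSpace ℝ (Fin d) × Z) := {y | M < ‖Γ y.1 y.2‖} with hC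
  have hCm : MeasurableSet C := measurableSet_lt measurable_const hΓ.norm
  have hXm := measurable_chain hζ hf hX0 hX
  have hpre := measurableSet_preimage ((hXm t).prodMk (hζ t)) hCm
  calc _ ≤ P ((fun ω => (X t ω, ζ t ω)) ⁻¹' C) := by
        refine measure_mono fun ω hω => ?_
        by_contra hcon
        exact hω.2 ⟨hunit t ω, hω.1, not_lt.1 hcon⟩
    _ = ∫⁻ ω, C.indicator 1 (X t ω, ζ t ω) ∂P := (lintegral_indicator_one hpre).symm
    _ = ∫⁻ ω, ∫⁻ z, C.indicator 1 (X t ω, z) ∂ν ∂P :=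
        lintegral_chain hζ hindep hlaw hf hX0 hX t (φ := fun v z => C.indicator 1 (v, z))
          (measurable_one.indicator hCm)
    _ = ∫⁻ ω, ν {z | M < ‖Γ (X t ω) z‖} ∂P := by
        refine lintegral_congr fun ω => ?_
        exact lintegral_indicator_one (measurable_prodMk_left hCm)
    _ ≤ ∫⁻ _, ENNReal.ofReal β ∂P := lintegral_mono fun ω => htail _ (hunit t ω)
    _ = _ := by rw [lintegral_const, measure_univ, mul_one]

end SSGD

set_option maxHeartbeats 1000000 in
theorem mainTheorem1 {d : ℕ} (hd : 2 ≤ d)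
    {Ω Z : Type*} [MeasurableSpace Ω] [MeasurableSpace Z]
    (P : Measure Ω) [IsProbabilityMeasure P] (ν : Measure Z) [IsProbabilityMeasure ν]
    -- the samples are i.i.d. with law ν
    (ζ : ℕ → Ω → Z) (hζ_meas : ∀ t, Measurable (ζ t)) (hζ_indep : iIndepFun ζ P)
    (hζ_law : ∀ t, Measure.map (ζ t) P = ν)
    -- objective, scaling, stochastic scaled gradient
    (F D : EuclideanSpace ℝ (Fin d) → ℝ)
    (Γ : EuclideanSpace ℝ (Fin d) → Z → EuclideanSpace ℝ (Fin d))
    (hΓ_meas : Measurable (Function.uncurry Γ))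
    (hF_diff : ∀ v : EuclideanSpace ℝ (Fin d), ‖v‖ = 1 → DifferentiableAt ℝ F v)
    (hD_pos : ∀ v : EuclideanSpace ℝ (Fin d), ‖v‖ = 1 → 0 < D v)
    (hΓ_mean : ∀ v : EuclideanSpace ℝ (Fin d), ‖v‖ = 1 →
      ∫ z, Γ v z ∂ν = D v • gradient F v)
    -- local minimizer with positive definite manifold Hessian on the tangent space
    (vs : EuclideanSpace ℝ (Fin d)) (hvs : ‖vs‖ = 1)
    (hvs_min : IsLocalMinOn F (Metric.sphere 0 1) vs)
    (μ : ℝ) (hμ : 0 < μ)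
    (hμ_hess : ∀ u : EuclideanSpace ℝ (Fin d), inner ℝ u vs = 0 → ‖u‖ = 1 →
      μ ≤ inner ℝ u (SSGD.manifoldHessian F vs u))
    -- smoothness near the minimizer
    (δ L_D L_F L_K L_Q : ℝ) (hδ : 0 < δ) (hδ_one : δ ≤ 1)
    (hsmooth : SSGD.Smoothness D F vs δ L_D L_F L_K L_Q)
    -- sub-Weibull tails
    (α V : ℝ) (hα : 0 < α) (hα_two : α ≤ 2) (hV : 0 < V)
    (htail : SSGD.SubWeibull ν Γ α V)
    (ρ : ℝ) (hρ : ρ = SSGD.rho (D vs) L_D L_F L_K L_Q)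
    -- warm start
    (v₀ : EuclideanSpace ℝ (Fin d)) (hv₀ : ‖v₀‖ = 1)
    (hwarm : ‖v₀ - vs‖ ≤ min (D vs * μ / (2 ^ 5 * ρ)) (δ / 2))
    -- step size
    (η ε : ℝ) (hη : 0 < η) (hε : 0 < ε) (hε_one : ε < 1)
    (hscale : η ≤ min
      (D vs ^ 3 * μ ^ 3 / (2 ^ 24 * SSGD.G α ^ 2 * V ^ 2 * ρ ^ 2) *
        (Real.log ε⁻¹) ^ (-((α + 2) / α)))
      (D vs * μ * δ ^ 2 / (2 ^ 17 * SSGD.G α ^ 2 * V ^ 2) *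
        (Real.log ε⁻¹) ^ (-((α + 2) / α))))
    (hη_lt : η < 1 / (D vs * μ))
    (Pr : EuclideanSpace ℝ (Fin d) → EuclideanSpace ℝ (Fin d))
    (hPr : SSGD.IsSphereProjection Pr)
    (T : ℕ) (hT : SSGD.K (D vs) μ ρ V α η ε * SSGD.Tstar (D vs) μ η ≤ T) :
    ∃ H : Set Ω, MeasurableSet H ∧
      1 - (14 + 8 * (3 / α) ^ (2 / α) * (Real.log ε⁻¹) ^ (-((α + 2) / α))) * T * ε ≤ P.real H ∧
      ∀ ω ∈ H, ∀ t : ℕ, SSGD.K (D vs) μ ρ V α η ε * SSGD.Tstar (D vs) μ η ≤ t → t ≤ T →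
        ‖SSGD.iterate Pr η Γ ζ v₀ t ω - vs‖ ≤
          (2 : ℝ) ^ (17 / 2 : ℝ) * SSGD.G α * V / Real.sqrt (D vs * μ) *
            (Real.log ε⁻¹) ^ ((α + 2) / (2 * α)) * η ^ (1 / 2 : ℝ) := by
  have hDs : 0 < D vs := hD_pos vs hvs
  have hDμ : 0 < D vs * μ := mul_pos hDs hμ
  have hρ0 : 0 < ρ := by
    have := hsmooth.pos_D; have := hsmooth.pos_F; have := hsmooth.pos_K; have := hsmooth.pos_Q
    rw [hρ]; unfold SSGD.rho; positivity
  have hl0 : 0 < Real.log ε⁻¹ := Real.log_pos ((one_lt_inv₀ hε).2 hε_one)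
  have hη_lt' : D vs * μ * η < 1 := by
    rw [lt_div_iff₀ hDμ] at hη_lt
    linarith
  have hy0 : 0 < D vs * μ * η := by positivity
  have hcoef : 14 ≤ 14 + 8 * (3 / α) ^ (2 / α) * (Real.log ε⁻¹) ^ (-((α + 2) / α)) :=
    le_add_of_nonneg_right (by positivity)
  have hTε : (0 : ℝ) ≤ T * ε := by positivity
  have hcoefT := mul_le_mul_of_nonneg_right hcoef hTε
  -- otherwise the probability bound is void
  by_cases hbig : 1 ≤ 14 * T * ε
  · refine ⟨∅, MeasurableSet.empty, ?_, fun ω hω => absurd hω (Set.notMem_empty ω)⟩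
    rw [measureReal_empty]
    linarith
  push Not at hbig
  set N := SSGD.K (D vs) μ ρ V α η ε * SSGD.Tstar (D vs) μ η with hN
  have hTs1 := SSGD.one_le_Tstar hy0 hη_lt'
  have hK1 : 1 ≤ SSGD.K (D vs) μ ρ V α η ε := Nat.le_add_left 1 _
  have hTsN : SSGD.Tstar (D vs) μ η ≤ N := Nat.le_mul_of_pos_left _ hK1
  have hN1 : 1 ≤ N := hTs1.trans hTsN
  have hε7 : 7 * ε ≤ D vs * μ * η := by
    refine SSGD.le_rate_of_Tstar_mul_lt hy0 hη_lt' hε (lt_of_le_of_lt ?_ hbig)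
    have : (SSGD.Tstar (D vs) μ η : ℝ) ≤ T := by exact_mod_cast hTsN.trans hT
    gcongr
  -- `ε ≤ 1 / 14 < exp (-1)`
  have hl1 : 1 ≤ Real.log ε⁻¹ := by
    have hT1 : (1 : ℝ) ≤ T := by exact_mod_cast hN1.trans hT
    have hε14 : 14 * ε ≤ 1 := by nlinarith
    rw [Real.le_log_iff_exp_le (inv_pos.2 hε), le_inv_comm₀ (Real.exp_pos 1) hε]
    have he := Real.exp_one_lt_d9
    rw [← one_div, le_div_iff₀ (Real.exp_pos 1)]
    nlinarith
  set l := Real.log ε⁻¹ with hl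
  set g := SSGD.G α with hg
  have hg1 : 1 ≤ g := SSGD.one_le_G hα
  have hg2 : 1 ≤ g ^ 2 := one_le_pow₀ hg1
  -- the truncation level, and the stationary variance level of the squared distance
  set M := V * l ^ (1 / α) with hM
  have hM0 : 0 < M := by positivity
  have hVM : V ≤ M := le_mul_of_one_le_right hV.le (Real.one_le_rpow hl1 (by positivity))
  have hMl : M ^ 2 * l = V ^ 2 * l ^ ((α + 2) / α) := by
    rw [hM, mul_pow, mul_assoc, ← Real.rpow_natCast (l ^ (1 / α)), ← Real.rpow_mul hl0.le,
      ← Real.rpow_add_one hl0.ne']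
    congr 2
    push_cast
    field_simp
    ring
  set σ := V ^ 2 * l ^ ((α + 2) / α) * η / (D vs * μ) with hσ
  have hσ0 : 0 < σ := by positivity
  have hσM : σ * (D vs * μ) = M ^ 2 * l * η := by
    rw [hσ, hMl]; field_simp
  have hlneg : l ^ (-((α + 2) / α)) * l ^ ((α + 2) / α) = 1 := by
    rw [← Real.rpow_add hl0, neg_add_cancel, Real.rpow_zero]
  have hrw : 0 < l ^ ((α + 2) / α) := by positivity
  have hσ1 : 2 ^ 14 * g ^ 2 * σ ≤ (D vs * μ / (2 ^ 5 * ρ)) ^ 2 := by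
    have h := mul_le_mul_of_nonneg_right (hscale.trans (min_le_left _ _)) hrw.le
    rw [mul_assoc, hlneg, mul_one, le_div_iff₀ (by positivity)] at h
    rw [hσ, div_pow, le_div_iff₀ (by positivity), ← mul_div_assoc, div_mul_eq_mul_div,
      div_le_iff₀ hDμ]
    calc _ = η * l ^ ((α + 2) / α) * (2 ^ 24 * g ^ 2 * V ^ 2 * ρ ^ 2) := by ring
      _ ≤ _ := h
      _ = _ := by ring
  have hσ2 : 2 ^ 15 * g ^ 2 * σ ≤ (δ / 2) ^ 2 := by
    have h := mul_le_mul_of_nonneg_right (hscale.trans (min_le_right _ _)) hrw.le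
    rw [mul_assoc, hlneg, mul_one, le_div_iff₀ (by positivity)] at h
    rw [hσ, ← mul_div_assoc, div_le_iff₀ hDμ]
    have h' : 4 * (2 ^ 15 * g ^ 2 * (V ^ 2 * l ^ ((α + 2) / α) * η)) ≤ D vs * μ * δ ^ 2 := by
      calc _ = η * l ^ ((α + 2) / α) * (2 ^ 17 * g ^ 2 * V ^ 2) := by ring
        _ ≤ _ := h
    linarith
  set r := min (D vs * μ / (2 ^ 5 * ρ)) (δ / 2) with hr
  have hr0 : 0 < r := lt_min (by positivity) (by positivity)
  have hrδ : r ≤ δ / 2 := min_le_right _ _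
  have hrρ : r ≤ D vs * μ / (2 ^ 5 * ρ) := min_le_left _ _
  have hgσ : σ ≤ g ^ 2 * σ := le_mul_of_one_le_left hσ0.le hg2
  have hσr : 2 ^ 14 * (g ^ 2 * σ) ≤ r ^ 2 := by
    rcases min_choice (D vs * μ / (2 ^ 5 * ρ)) (δ / 2) with h | h
    · rw [hr, h]; linarith
    · rw [hr, h]; linarith
  have hηM : η * M ≤ 1 / 2 := by
    have h1 : (η * M) ^ 2 * l = D vs * μ * η * σ := by
      calc (η * M) ^ 2 * l = η * (M ^ 2 * l * η) := by ring
        _ = _ := by rw [← hσM]; ring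
    have h2 : r ^ 2 ≤ (1 / 2) ^ 2 := by gcongr; linarith
    have h3 : (η * M) ^ 2 ≤ (η * M) ^ 2 * l := le_mul_of_one_le_right (sq_nonneg _) hl1
    have h4 : D vs * μ * η * σ ≤ 1 * σ := mul_le_mul_of_nonneg_right hη_lt'.le hσ0.le
    exact le_of_sq_le_sq (by linarith) (by norm_num)
  set B := 2 * V * (1 / α) ^ (1 / α) * Real.sqrt ε with hBdef
  have hBsq : B ^ 2 ≤ 4 / 7 * g ^ 2 * V ^ 2 * (D vs * μ * η) := by
    have h1 : ((1 / α) ^ (1 / α)) ^ 2 ≤ g ^ 2 := by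
      gcongr
      exact SSGD.rpow_one_div_le_G hα
    calc B ^ 2 = 4 * V ^ 2 * ((1 / α) ^ (1 / α)) ^ 2 * ε := by
          rw [hBdef, mul_pow, Real.sq_sqrt hε.le]; ring
      _ ≤ 4 * V ^ 2 * g ^ 2 * (D vs * μ * η / 7) := by gcongr; linarith
      _ = _ := by ring
  set κ := 4 * η ^ 2 * M ^ 2 + η * (B ^ 2 / (3 / 10 * (D vs * μ))) with hκ
  have hκ0 : 0 ≤ κ := by positivity
  -- accumulated over all steps, the second-order and bias terms stay at the stationary level
  have hκσ : κ / (1 - (1 - D vs * μ * η)) ≤ 6 * (g ^ 2 * σ) := by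
    rw [sub_sub_cancel, div_le_iff₀ hy0]
    have h1 : M ^ 2 * η ≤ σ * (D vs * μ) := by
      rw [hσM]
      have : M ^ 2 * η * 1 ≤ M ^ 2 * η * l := by gcongr
      linarith
    have h2 : 4 * η ^ 2 * M ^ 2 ≤ 4 * (g ^ 2 * σ) * (D vs * μ * η) := by
      calc _ = 4 * η * (M ^ 2 * η) := by ring
        _ ≤ 4 * η * (σ * (D vs * μ)) := by gcongr
        _ ≤ 4 * η * (g ^ 2 * σ * (D vs * μ)) := by gcongr
        _ = _ := by ring
    have h3 : B ^ 2 / (3 / 10 * (D vs * μ)) ≤ 2 * (g ^ 2 * σ) * (D vs * μ) := by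
      rw [div_le_iff₀ (by positivity)]
      calc B ^ 2 ≤ 4 / 7 * g ^ 2 * V ^ 2 * (D vs * μ * η) := hBsq
        _ ≤ 4 / 7 * g ^ 2 * M ^ 2 * (D vs * μ * η) := by gcongr
        _ = 4 / 7 * g ^ 2 * (D vs * μ) * (M ^ 2 * η) := by ring
        _ ≤ 4 / 7 * g ^ 2 * (D vs * μ) * (σ * (D vs * μ)) := by gcongr
        _ ≤ 6 / 10 * g ^ 2 * (D vs * μ) * (σ * (D vs * μ)) := by
            have : 0 ≤ g ^ 2 * (D vs * μ) * (σ * (D vs * μ)) := by positivity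
            linarith
        _ = _ := by ring
    have h4 := mul_le_mul_of_nonneg_left h3 hη.le
    linarith
  set L := 3 / 20 * (D vs * μ) / (η * M ^ 2) with hL
  have hL0 : 0 ≤ L := by positivity
  have hLσ : L * σ = 3 / 20 * l := by
    rw [hL, div_mul_eq_mul_div, div_eq_iff (by positivity)]
    calc 3 / 20 * (D vs * μ) * σ = 3 / 20 * (σ * (D vs * μ)) := by ring
      _ = _ := by rw [hσM]; ring
  -- a gap of `7 g² σ` suffices, because `7 L σ = 1.05 l`
  have hexp : ∀ a : ℝ, 7 * (g ^ 2 * σ) ≤ a → Real.exp (-(L * a)) ≤ ε := by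
    intro a ha
    rw [← Real.le_log_iff_exp_le hε]
    have h1 : L * (7 * σ) ≤ L * a := by gcongr; linarith
    have h2 : Real.log ε = -l := by rw [hl, Real.log_inv, neg_neg]
    rw [h2]
    linarith
  have hf_meas : Measurable (Function.uncurry fun v z => Pr (v - η • Γ v z)) := by
    have h1 : Measurable fun y : EuclideanSpace ℝ (Fin d) × Z => Γ y.1 y.2 := hΓ_meas
    exact hPr.measurable.comp (measurable_fst.sub (h1.const_smul η))
  have hΓv : ∀ v, Measurable (Γ v) := fun v => hΓ_meas.comp measurable_prodMk_left
  have hΓ_int : ∀ v : EuclideanSpace ℝ (Fin d), ‖v‖ = 1 → Integrable (Γ v) ν := fun v hv =>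
    (integrable_norm_iff (hΓv v).aestronglyMeasurable).1
      (SSGD.integrable_of_lintegral_exp_le hα hV (hΓv v).norm (fun z => norm_nonneg _) (htail v hv))
  have hX0 : ∀ ω, SSGD.iterate Pr η Γ ζ v₀ 0 ω = v₀ := fun ω => rfl
  have hXs : ∀ t ω, SSGD.iterate Pr η Γ ζ v₀ (t + 1) ω
      = (fun v z => Pr (v - η • Γ v z)) (SSGD.iterate Pr η Γ ζ v₀ t ω) (ζ t ω) := fun t ω => rfl
  have hXm := SSGD.measurable_chain hζ_meas hf_meas hX0 hXs
  have hXunit : ∀ t ω, ‖SSGD.iterate Pr η Γ ζ v₀ t ω‖ = 1 := by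
    intro t ω
    cases t with
    | zero => exact hv₀
    | succ t => exact (hPr _).1
  have hA := SSGD.measurableSet_goodSteps hΓ_meas vs r M
  have hx : Measurable fun v : EuclideanSpace ℝ (Fin d) => ‖v - vs‖ ^ 2 := by fun_prop
  have hrρ' : SSGD.rho (D vs) L_D L_F L_K L_Q * r ≤ D vs * μ / 32 := by
    rw [← hρ]
    rw [le_div_iff₀ (by positivity)] at hrρ
    linarith
  have htight := SSGD.measure_good_inter_lt_le hζ_meas hζ_indep hζ_law hf_meas hX0 hXs hA hx hL0
    (sub_nonneg.2 hη_lt'.le) (by linarith : 1 - D vs * μ * η < 1) hκ0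
    (fun l' hl' hl'L v => SSGD.lintegral_goodSteps_exp_le hΓ_meas hΓ_int hΓ_mean hvs hvs_min hDs hμ
      hμ_hess hδ hδ_one hsmooth hPr hη hM0 hr0.le hηM
      (fun v hv => SSGD.integral_indicator_truncation_le hα hV (hΓv v).norm
        (fun z => norm_nonneg _) (htail v hv) hε hε_one) hrδ hrρ' hl' hl'L v)
  have hx0 : ‖v₀ - vs‖ ^ 2 ≤ r ^ 2 := by gcongr
  have hq0 : 0 ≤ 1 - D vs * μ * η := sub_nonneg.2 hη_lt'.le
  have hq1 : 1 - D vs * μ * η ≤ 1 := by linarith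
  obtain ⟨H, hHm, hHP, hHb⟩ := SSGD.exists_event_of_step_bounds (P := P) hζ_meas hXm hA hx
    (a := 2 * r ^ 2) (b := 2 ^ 17 * (g ^ 2 * σ)) hε.le hN1 (T := T)
    (SSGD.measure_notMem_goodSteps_le hζ_meas hζ_indep hζ_law hΓ_meas hf_meas hX0 hXs hXunit
      fun v hv => SSGD.measure_truncation_lt_le hα hV (hΓv v).norm (htail v hv) hε hε_one)
    (by
      intro t
      refine (htight t (2 * r ^ 2)).trans (ENNReal.ofReal_le_ofReal (hexp _ ?_))
      have h1 : (1 - D vs * μ * η) ^ t * ‖v₀ - vs‖ ^ 2 ≤ 1 * r ^ 2 := by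
        gcongr
        exact pow_le_one₀ hq0 hq1
      have : 0 < g ^ 2 * σ := by positivity
      linarith)
    (by
      intro t ht
      refine (htight t _).trans (ENNReal.ofReal_le_ofReal (hexp _ ?_))
      have h1 : (1 - D vs * μ * η) ^ t ≤ (1 / 4) ^ SSGD.K (D vs) μ ρ V α η ε := by
        calc _ ≤ (1 - D vs * μ * η) ^ N := pow_le_pow_of_le_one hq0 hq1 ht
          _ = ((1 - D vs * μ * η) ^ SSGD.Tstar (D vs) μ η) ^ SSGD.K (D vs) μ ρ V α η ε := by
              rw [← pow_mul, mul_comm (SSGD.Tstar _ _ _), hN]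
          _ ≤ _ := by
              gcongr
              exact SSGD.pow_Tstar_le hy0 hη_lt'
      have h2 : (1 - D vs * μ * η) ^ t * ‖v₀ - vs‖ ^ 2 ≤ σ / 4 := by
        calc _ ≤ (1 / 4) ^ SSGD.K (D vs) μ ρ V α η ε * (D vs * μ / (2 ^ 5 * ρ)) ^ 2 := by
              gcongr
              exact hwarm.trans hrρ
          _ ≤ _ := by
              rw [mul_comm]
              exact SSGD.sq_mul_pow_K_le hDs hμ hρ0 hV hη hl0
      linarith)
  refine ⟨H, hHm, by linarith, fun ω hω t h1 h2 => ?_⟩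
  refine le_of_sq_le_sq ((hHb ω hω t h1 h2).trans_eq ?_) (by positivity)
  have hlsq := SSGD.rpow_half_exponent_sq α hl0.le
  have hηsq : (η ^ (1 / 2 : ℝ)) ^ 2 = η := by
    rw [← Real.sqrt_eq_rpow, Real.sq_sqrt hη.le]
  have h2sq : ((2 : ℝ) ^ (17 / 2 : ℝ)) ^ 2 = 2 ^ 17 := by
    rw [← Real.rpow_natCast, ← Real.rpow_mul two_pos.le]
    norm_num
  rw [mul_pow, mul_pow, div_pow, mul_pow, mul_pow, hlsq, hηsq, h2sq, Real.sq_sqrt hDμ.le, hσ]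
  ring
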